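/- A represented space is a set $X$ with a partial surjection $\delta_X:\subseteq\mathbb{N}^{\mathbb{N}}\to X$; if $\delta_X(p)=x$, then $p$ is a name of $x$. A realizer of a multivalued function $f:\subseteq X\rightrightarrows Y$ between represented spaces is a partial function $G:\subseteq\mathbb{N}^{\mathbb{N}}\to\mathbb{N}^{\mathbb{N}}$ that maps each name of each $x\in\operatorname{dom}(f)$ to a name of some element of $f(x)$, and $f$ is computable if it has a computable realizer. We write $f\leq_{\mathrm W}g$ ($f$ is Weihrauch reducible to $g$) if there are computable $K,H:\subseteq\mathbb{N}^{\mathbb{N}}\to\mathbb{N}^{\mathbb{N}}$ such that $p\mapsto K\langle p,G(H(p))\rangle$ is a realizer of $f$ for every realizer $G$ of $g$. The product is $(f\times g)(x,y)=f(x)\times g(y)$, and the parallelization $\widehat f$ maps a sequence $(x_i)_{i\in\mathbb{N}}$ to the sequences $(y_i)_{i\in\mathbb{N}}$ with $y_i\in f(x_i)$ for all $i$. All games have two players, $a$ and $b$, who produce a play $x\in\{0,1\}^{\mathbb{N}}$ bit by bit; a function $d:\{0,1\}^*\to\{a,b\}$ says whose turn it is after each finite history. A strategy profile is a function $\sigma:\{0,1\}^*\to\{0,1\}$.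 It is a Nash equilibrium if no player can obtain an outcome that this player strictly prefers by changing $\sigma$ only at histories where it is this player's turn. It is a subgame-perfect equilibrium if, for every finite history, the same holds for the game started at that history. Let $\Gamma$ be a represented pointclass on $\{0,1\}^{\mathbb{N}}$, i.e. a represented space whose elements are subsets of $\{0,1\}^{\mathbb{N}}$. Assume that $\emptyset,\{0,1\}^{\mathbb{N}}\in\Gamma$, that $\Gamma$ is closed, uniformly computably in the names, under the rescalings $(w,A)\mapsto wA=\{wx\mid x\in A\}$ ($w\in\{0,1\}^*$), under the inverse operation $(w,wA)\mapsto A$, and under intersection with clopen sets, and that $\Gamma$ is determined: for every $d$ and every $A\in\Gamma$, in the win/lose game where $a$ wins if the play is in $A$ and $b$ wins otherwise, one of the players has a winning strategy. Consider the following problems. - $\mathrm{Det}_\Gamma$: given $d$ (as a look-up table) and a $\Gamma$-name of $A\in\Gamma$, find a Nash equilibrium of that win/lose game. - $\mathrm{Win}_\Gamma$: on the same inputs, decide which player has a winning strategy. - $\mathrm{SPE}_\Gamma$: given a game with finitely many outcomes, with a valuation $v$ of the plays by outcomes and with antagonistic preferences ($\prec_a$ is the inverse relation of $\prec_b$, and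 the inverses of both relations are well-founded), such that $v^{-1}(U)\in\Gamma$ for every set $U$ of outcomes that is upward closed with respect to $\prec_a$ or with respect to $\prec_b$, find a subgame-perfect equilibrium. The game is given by the number of its outcomes, look-up tables for $d$, $\prec_a$, $\prec_b$, and $\Gamma$-names of all these sets $v^{-1}(U)$. Then $$\mathrm{SPE}_\Gamma\ \leq_{\mathrm W}\ \widehat{\mathrm{Win}_\Gamma}\times\widehat{\mathrm{Det}_\Gamma}.$$ -/

import Mathlib

/-! ### Baire space, Cantor space, computability -/

namespace Weih

open Encodable

/-- Baire space `ℕ^ℕ`. -/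
abbrev Baire : Type := ℕ → ℕ

/-- Cantor space `{0,1}^ℕ`. -/
abbrev Cantor : Type := ℕ → Bool

/-- The pairing `⟨p, q⟩` on Baire space: `p` on the even places, `q` on the odd places. -/
def pair (p q : Baire) : Baire := fun n => cond n.bodd (q n.div2) (p n.div2)

/-- First projection of the pairing. -/
def fstB (r : Baire) : Baire := fun n => r (2 * n)

/-- Second projection of the pairing. -/
def sndB (r : Baire) : Baire := fun n => r (2 * n + 1)

/-- The `i`-th component of `p` read as a countable tuple `⟨p₀, p₁, p₂, …⟩`. -/
def sect (p : Baire) (i : ℕ) : Baire := fun n => p (Nat.pair i n)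

/-- The countable tuple `⟨s 0, s 1, s 2, …⟩`. -/
def join (s : ℕ → Baire) : Baire := fun n => s n.unpair.1 n.unpair.2

theorem fstB_pair (p q : Baire) : fstB (pair p q) = p := by
  funext n; simp [fstB, pair, Nat.div2_val]

theorem sndB_pair (p q : Baire) : sndB (pair p q) = q := by
  funext n
  simp [sndB, pair, Nat.div2_val]

theorem sect_join (s : ℕ → Baire) (i : ℕ) : sect (join s) i = s i := by
  funext n; simp [sect, join]

/-- Partial recursive functionals: the functions `ℕ ⇀ ℕ` computed relative to an oracle
`p : ℕ → ℕ`, uniformly in `p`. The clauses are those of the partial recursive functions, together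
with oracle queries. -/
inductive OracleRec : (Baire → ℕ →. ℕ) → Prop
  | zero : OracleRec fun _ _ => Part.some 0
  | succ : OracleRec fun _ n => Part.some (n + 1)
  | left : OracleRec fun _ n => Part.some n.unpair.1
  | right : OracleRec fun _ n => Part.some n.unpair.2
  | oracle : OracleRec fun p n => Part.some (p n)
  | pair {f h : Baire → ℕ →. ℕ} (hf : OracleRec f) (hh : OracleRec h) :
      OracleRec fun p n => Nat.pair <$> f p n <*> h p n
  | comp {f h : Baire → ℕ →. ℕ} (hf : OracleRec f) (hh : OracleRec h) :
      OracleRec fun p n => h p n >>= f p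
  | prec {f h : Baire → ℕ →. ℕ} (hf : OracleRec f) (hh : OracleRec h) :
      OracleRec fun p m =>
        m.unpair.2.rec (f p m.unpair.1) fun y IH =>
          IH >>= fun i => h p (Nat.pair m.unpair.1 (Nat.pair y i))
  | rfind {f : Baire → ℕ →. ℕ} (hf : OracleRec f) :
      OracleRec fun p a =>
        Nat.rfind fun n => (fun m => decide (m = 0)) <$> f p (Nat.pair a n)

/-- A partial function on Baire space is computable if an oracle machine that is given `p` in its
domain as an oracle computes all the values of the image of `p`. -/
def ComputableFun (F : Baire →. Baire) : Prop :=
  ∃ Φ, OracleRec Φ ∧ ∀ p q, q ∈ F p → ∀ n, q n ∈ Φ p n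

/-! ### Represented spaces, multivalued functions, Weihrauch reducibility -/

/-- A represented space: a set with a partial surjection from Baire space, which is given by its
graph; `names p x` says that `p` is a name of `x`. -/
structure RepSpace where
  carrier : Type
  names : Baire → carrier → Prop
  functional : ∀ p x y, names p x → names p y → x = y
  surjective : ∀ x, ∃ p, names p x

/-- The canonical name `0ⁿ10^ℕ` of a natural number `n`. -/
def natName (n : ℕ) : Baire := fun k => if k = n then 1 else 0

theorem natName_injective {m n : ℕ} (h : natName m = natName n) : m = n := by
  by_contra hne
  have := congrFun h m
  simp [natName, hne] at this

/-- A discrete countable set, represented through codes of its elements. -/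
def discreteSpace (Y : Type) [Encodable Y] : RepSpace where
  carrier := Y
  names p y := p = natName (encode y)
  functional p x y hx hy := encode_injective (natName_injective (hx.symm.trans hy))
  surjective y := ⟨_, rfl⟩

/-- The space of functions on the finite binary words, represented as look-up tables. -/
def tableSpace (Y : Type) [Encodable Y] : RepSpace where
  carrier := List Bool → Y
  names p f := ∀ w, p (encode w) = encode (f w)
  functional p f g hf hg := funext fun w => encode_injective ((hf w).symm.trans (hg w))
  surjective f := ⟨fun n => ((decode n : Option (List Bool)).map fun w => encode (f w)).getD 0,
    fun w => by simp⟩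

/-- The product of two represented spaces. -/
def prodSpace (X Y : RepSpace) : RepSpace where
  carrier := X.carrier × Y.carrier
  names r z := X.names (fstB r) z.1 ∧ Y.names (sndB r) z.2
  functional _ _ _ hz hw :=
    Prod.ext (X.functional _ _ _ hz.1 hw.1) (Y.functional _ _ _ hz.2 hw.2)
  surjective z := by
    obtain ⟨p, hp⟩ := X.surjective z.1
    obtain ⟨q, hq⟩ := Y.surjective z.2
    exact ⟨pair p q, by rwa [fstB_pair], by rwa [sndB_pair]⟩

/-- The countable power `X^ℕ` of a represented space. -/
def seqSpace (X : RepSpace) : RepSpace where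
  carrier := ℕ → X.carrier
  names p x := ∀ i, X.names (sect p i) (x i)
  functional _ _ _ hx hy := funext fun i => X.functional _ _ _ (hx i) (hy i)
  surjective x := by
    choose s hs using fun i => X.surjective (x i)
    exact ⟨join s, fun i => by rw [sect_join]; exact hs i⟩

/-- A partial multivalued function between represented spaces: `val x` is the set of the valid
outputs on the input `x`, and `dom` is the set of the admitted inputs. -/
structure MultiFun (X Y : RepSpace) where
  dom : Set X.carrier
  val : X.carrier → Set Y.carrier

/-- `G` is a realizer of `f`: it is defined on every name of every admitted input `x`, and yields a
name of a valid output there. (So `f` has a realizer only if each admitted input has a valid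
output.) -/
def Realizes {X Y : RepSpace} (G : Baire →. Baire) (f : MultiFun X Y) : Prop :=
  ∀ p x, X.names p x → x ∈ f.dom → ∃ q ∈ G p, ∃ y ∈ f.val x, Y.names q y

/-- A multivalued function is computable if it has a computable realizer. -/
def MultiFun.IsComputable {X Y : RepSpace} (f : MultiFun X Y) : Prop :=
  ∃ F, ComputableFun F ∧ Realizes F f

/-- Weihrauch reducibility: there are computable `K`, `H` such that `K⟨id, GH⟩` is a realizer of `f`
for every realizer `G` of `g`. -/
def WeihrauchReducible {X Y Z W : RepSpace} (f : MultiFun X Y) (g : MultiFun Z W) : Prop :=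
  ∃ K H : Baire →. Baire, ComputableFun K ∧ ComputableFun H ∧
    ∀ G : Baire →. Baire, Realizes G g →
      Realizes (fun p => H p >>= fun h => G h >>= fun q => K (pair p q)) f

/-- The product `f × g`. -/
def MultiFun.prod {X Y Z W : RepSpace} (f : MultiFun X Y) (g : MultiFun Z W) :
    MultiFun (prodSpace X Z) (prodSpace Y W) where
  dom := {x | x.1 ∈ f.dom ∧ x.2 ∈ g.dom}
  val x := {y | y.1 ∈ f.val x.1 ∧ y.2 ∈ g.val x.2}

/-- The parallelization of `f`. -/
def MultiFun.parallel {X Y : RepSpace} (f : MultiFun X Y) :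
    MultiFun (seqSpace X) (seqSpace Y) where
  dom := {x | ∀ i, x i ∈ f.dom}
  val x := {y | ∀ i, y i ∈ f.val (x i)}

/-! ### Infinite sequential games -/

/-- An infinite sequential game with agents `A`, choices `C`, outcomes `O`: `d` says whose turn it
is, `v` values the plays, and `pref a x y` says that `a` strictly prefers `y` to `x`. -/
structure SeqGame (A C O : Type) where
  d : List C → A
  v : (ℕ → C) → O
  pref : A → O → O → Prop

/-- The history that is reached after `n` further moves from `l`, if `σ` is played. -/
def history {C : Type} (σ : List C → C) (l : List C) : ℕ → List C
  | 0 => l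
  | n + 1 => history σ l n ++ [σ (history σ l n)]

/-- The play that is induced by the strategy profile `σ` starting at the history `l`. -/
def play {C : Type} (σ : List C → C) (l : List C) : ℕ → C :=
  fun n => if h : n < l.length then l[n] else σ (history σ l (n - l.length))

namespace SeqGame

variable {A C O : Type}

/-- The outcome that is induced by `σ` starting at `l`. -/
def outcome (G : SeqGame A C O) (σ : List C → C) (l : List C) : O := G.v (play σ l)

/-- `τ` arises from `σ` by a change of the strategy of agent `a` alone. -/
def Deviation (G : SeqGame A C O) (a : A) (σ τ : List C → C) : Prop :=
  ∀ w, G.d w ≠ a → τ w = σ w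

/-- `σ` is an equilibrium of the game started at `l`: no agent can induce an outcome that he prefers
by changing his own strategy. -/
def IsEquilibriumAt (G : SeqGame A C O) (l : List C) (σ : List C → C) : Prop :=
  ∀ a τ, G.Deviation a σ τ → ¬ G.pref a (G.outcome σ l) (G.outcome τ l)

/-- Nash equilibria. -/
def IsNash (G : SeqGame A C O) (σ : List C → C) : Prop := G.IsEquilibriumAt [] σ

/-- Subgame-perfect equilibria. -/
def IsSubgamePerfect (G : SeqGame A C O) (σ : List C → C) : Prop :=
  ∀ l, G.IsEquilibriumAt l σ

end SeqGame

/-- The win/lose game of the players `0` and `1` with turn function `d` in which player `0` wins the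
plays in `W` and player `1` wins the other ones. The outcome is the winner, and each player prefers
to be the winner. -/
noncomputable def winLose (d : List Bool → Fin 2) (W : Set Cantor) :
    SeqGame (Fin 2) Bool (Fin 2) where
  d := d
  v := by
    classical
    exact fun x => if x ∈ W then 0 else 1
  pref i x y := x ≠ i ∧ y = i

/-- Player `i` has a winning strategy `s` in the win/lose game: whatever the moves at the histories
where it is not the turn of `i`, the induced play is won by `i`. -/
def HasWinningStrategy (d : List Bool → Fin 2) (W : Set Cantor) (i : Fin 2) : Prop :=
  ∃ s : List Bool → Bool, ∀ σ : List Bool → Bool, (∀ w, d w = i → σ w = s w) →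
    (winLose d W).outcome σ [] = i

/-! ### Represented pointclasses -/

/-- A represented pointclass over Cantor space: a partial function from Baire space to the subsets
of Cantor space (given by its graph); its members are the sets that have a name. -/
structure RepPointclass where
  names : Baire → Set Cantor → Prop
  functional : ∀ p U V, names p U → names p V → U = V

/-- The infinite sequence `wx`. -/
def prepend (w : List Bool) (x : Cantor) : Cantor :=
  fun n => if h : n < w.length then w[n] else x (n - w.length)

/-- The set `{wx | x ∈ U}`. -/
def rescale (w : List Bool) (U : Set Cantor) : Set Cantor := {y | ∃ x ∈ U, y = prepend w x}

/-- The clopen set of the sequences with a prefix in the finite list `L`; each clopen subset of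
Cantor space is of this form. -/
def clopenOf (L : List (List Bool)) : Set Cantor := {y | ∃ w ∈ L, ∃ x, y = prepend w x}

namespace RepPointclass

/-- The members of a pointclass. -/
def Mem (Γ : RepPointclass) (U : Set Cantor) : Prop := ∃ p, Γ.names p U

/-- A represented pointclass as a represented space. -/
def space (Γ : RepPointclass) : RepSpace where
  carrier := {U : Set Cantor // Γ.Mem U}
  names p U := Γ.names p U.1
  functional p U V hU hV := Subtype.ext (Γ.functional p _ _ hU hV)
  surjective U := U.2

/-- The operation `(w, U) ↦ wU`. -/
def rescaling (Γ : RepPointclass) :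
    MultiFun (prodSpace (discreteSpace (List Bool)) Γ.space) Γ.space where
  dom := Set.univ
  val z := {V | V.1 = rescale z.1 z.2.1}

/-- The inverse operation `(w, wU) ↦ U`. -/
def rescalingInv (Γ : RepPointclass) :
    MultiFun (prodSpace (discreteSpace (List Bool)) Γ.space) Γ.space where
  dom := {z | ∃ U, z.2.1 = rescale z.1 U}
  val z := {V | z.2.1 = rescale z.1 V.1}

/-- The intersection of clopen sets with members of `Γ`. -/
def clopenInter (Γ : RepPointclass) :
    MultiFun (prodSpace (discreteSpace (List (List Bool))) Γ.space) Γ.space where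
  dom := Set.univ
  val z := {V | V.1 = z.2.1 ∩ clopenOf z.1}

/-- In every win/lose game in which the winning set of the first player is in `Γ`, one of the players
has a winning strategy. -/
def IsDetermined (Γ : RepPointclass) : Prop :=
  ∀ d W, Γ.Mem W → ∃ i, HasWinningStrategy d W i

/-- The standing assumptions on a determined pointclass: it is determined, contains the empty set and
the whole space, and is closed in a uniformly computable way under rescaling, its inverse, and
intersection with clopen sets. -/
structure IsDeterminedPointclass (Γ : RepPointclass) : Prop where
  determined : Γ.IsDetermined
  empty_mem : Γ.Mem ∅
  univ_mem : Γ.Mem Set.univ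
  rescaling_computable : Γ.rescaling.IsComputable
  rescalingInv_computable : Γ.rescalingInv.IsComputable
  clopenInter_computable : Γ.clopenInter.IsComputable

end RepPointclass

/-! ### The problems `Det`, `Win` and `SPE` -/

/-- The represented space of the two-player win/lose games in which the winning set of the first
player is in `Γ`: turn function and winning set. -/
def winLoseSpace (Γ : RepPointclass) : RepSpace := prodSpace (tableSpace (Fin 2)) Γ.space

/-- `Det_Γ`: find a Nash equilibrium of a win/lose game. -/
def Det (Γ : RepPointclass) : MultiFun (winLoseSpace Γ) (tableSpace Bool) where
  dom := Set.univ
  val z := {σ | (winLose z.1 z.2.1).IsNash σ}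

/-- `Win_Γ`: decide which player has a winning strategy in a win/lose game. -/
def Win (Γ : RepPointclass) : MultiFun (winLoseSpace Γ) (discreteSpace (Fin 2)) where
  dom := Set.univ
  val z := {i | HasWinningStrategy z.1 z.2.1 i}

/-- `U` is an upper set for the relation `r`. -/
def IsUpper {O : Type} (r : O → O → Prop) (U : Set O) : Prop :=
  ∀ x ∈ U, ∀ y, r x y → y ∈ U

/-- The two-player games with choices `{0,1}`, finitely many outcomes and antagonistic preferences
with well-founded inverses, such that for each upper set of outcomes with respect to the preference
of either player, the set of the plays that result in it is in `Γ`. -/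
structure AntagonisticGame (Γ : RepPointclass) where
  numOutcomes : ℕ
  game : SeqGame (Fin 2) Bool (Fin numOutcomes)
  antagonistic : ∀ x y, game.pref 0 x y ↔ game.pref 1 y x
  wellFounded : ∀ i, WellFounded fun x y => game.pref i y x
  measurable : ∀ i U, IsUpper (game.pref i) U → Γ.Mem (game.v ⁻¹' U)

/-- The subset of `{0, …, k-1}` with characteristic word `L`. -/
def wordSet (k : ℕ) (L : List Bool) : Set (Fin k) := {x | L[x.val]? = some true}

/-- `p` is a name of an antagonistic game: its components are the number of outcomes, the look-up
table of the turn function, the look-up table of the preferences, and a family of `Γ`-names of the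
sets of plays that result in the upper sets of outcomes, which is indexed by the players and the
characteristic words of the upper sets. -/
structure AntagonisticGame.IsName {Γ : RepPointclass} (p : Baire) (G : AntagonisticGame Γ) :
    Prop where
  num : sect p 0 0 = G.numOutcomes
  turn : ∀ w : List Bool, sect p 1 (encode w) = (G.game.d w).val
  pref_pos : ∀ i x y, G.game.pref i x y → sect p 2 (encode (i, x, y)) = 1
  pref_neg : ∀ i x y, ¬ G.game.pref i x y → sect p 2 (encode (i, x, y)) = 0
  upper : ∀ (i : Fin 2) (L : List Bool), L.length = G.numOutcomes →
    IsUpper (G.game.pref i) (wordSet G.numOutcomes L) →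
      Γ.names (sect (sect p 3) (encode (i, L))) (G.game.v ⁻¹' wordSet G.numOutcomes L)

theorem exists_word {k : ℕ} (U : Set (Fin k)) :
    ∃ L : List Bool, L.length = k ∧ wordSet k L = U := by
  classical
  refine ⟨List.ofFn fun x => decide (x ∈ U), by simp, ?_⟩
  ext x
  simp [wordSet]

theorem eq_of_upper {O : Type} {r : O → O → Prop} (hr : WellFounded fun x y => r y x) {x y : O}
    (h : ∀ U, IsUpper r U → (x ∈ U ↔ y ∈ U)) : x = y := by
  have up : ∀ z, IsUpper r {u | Relation.ReflTransGen r z u} := fun z u hu w hw =>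
    Relation.ReflTransGen.tail hu hw
  have hxy : Relation.ReflTransGen r x y := (h _ (up x)).1 Relation.ReflTransGen.refl
  have hyx : Relation.ReflTransGen r y x := (h _ (up y)).2 Relation.ReflTransGen.refl
  rcases Relation.reflTransGen_iff_eq_or_transGen.1 hxy with e | t
  · exact e.symm
  · have t2 : Relation.TransGen r x x := t.trans_left hyx
    have t3 : Relation.TransGen (fun x y => r y x) x x := Relation.transGen_swap.2 t2
    exact absurd t3 (hr.transGen.irrefl.irrefl x)

/-- The represented space of antagonistic games over `Γ`. -/
def gameSpace (Γ : RepPointclass) : RepSpace where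
  carrier := AntagonisticGame Γ
  names p G := G.IsName p
  functional := by
    rintro p ⟨k, ⟨d, v, r⟩, h1, h2, h3⟩ ⟨k', ⟨d', v', r'⟩, h1', h2', h3'⟩ hG hH
    obtain rfl : k = k' := hG.num.symm.trans hH.num
    obtain rfl : d = d' := funext fun w => Fin.ext ((hG.turn w).symm.trans (hH.turn w))
    obtain rfl : r = r' := by
      funext i x y
      have a1 := hG.pref_pos i x y
      have a2 := hG.pref_neg i x y
      have b1 := hH.pref_pos i x y
      have b2 := hH.pref_neg i x y
      simp only at a1 a2 b1 b2
      apply propext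
      constructor
      · intro h
        by_contra h4
        have := (a1 h).symm.trans (b2 h4)
        omega
      · intro h
        by_contra h4
        have := (b1 h).symm.trans (a2 h4)
        omega
    obtain rfl : v = v' := by
      funext x
      refine eq_of_upper (h2 0) fun U hU => ?_
      obtain ⟨L, hL, rfl⟩ := exists_word U
      have := Γ.functional _ _ _ (hG.upper 0 L hL hU) (hH.upper 0 L hL hU)
      exact Set.ext_iff.1 this x
    rfl
  surjective G := by
    classical
    have hc : ∀ q : Fin 2 × List Bool, ∃ c : Baire,
        IsUpper (G.game.pref q.1) (wordSet G.numOutcomes q.2) →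
          Γ.names c (G.game.v ⁻¹' wordSet G.numOutcomes q.2) := fun q => by
      by_cases h : IsUpper (G.game.pref q.1) (wordSet G.numOutcomes q.2)
      · obtain ⟨c, hc⟩ := G.measurable _ _ h
        exact ⟨c, fun _ => hc⟩
      · exact ⟨fun _ => 0, fun h2 => absurd h2 h⟩
    choose c hc using hc
    let p1 : Baire := fun n => ((decode n : Option (List Bool)).map fun w => (G.game.d w).val).getD 0
    let p2 : Baire := fun n =>
      ((decode n : Option (Fin 2 × Fin G.numOutcomes × Fin G.numOutcomes)).map fun q =>
        if G.game.pref q.1 q.2.1 q.2.2 then 1 else 0).getD 0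
    let p3 : ℕ → Baire := fun n =>
      ((decode n : Option (Fin 2 × List Bool)).map c).getD fun _ => 0
    refine ⟨join fun i => if i = 0 then fun _ => G.numOutcomes else if i = 1 then p1 else
      if i = 2 then p2 else join p3, ?_, ?_, ?_, ?_, ?_⟩
    · rw [sect_join]; simp
    · intro w; rw [sect_join]; simp [p1]
    · intro i x y h; rw [sect_join]; simp [p2, h]
    · intro i x y h; rw [sect_join]; simp [p2, h]
    · intro i L _ h
      have e : p3 (encode (i, L)) = c (i, L) := by simp only [p3, encodek]; rfl
      rw [sect_join]
      simp only [show (3 : ℕ) ≠ 0 by decide, show (3 : ℕ) ≠ 1 by decide,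
        show (3 : ℕ) ≠ 2 by decide, if_false, sect_join, e]
      exact hc (i, L) h

/-- `SPE_Γ`: find a subgame-perfect equilibrium of an antagonistic game. -/
def SPE (Γ : RepPointclass) : MultiFun (gameSpace Γ) (tableSpace Bool) where
  dom := Set.univ
  val G := {σ | G.game.IsSubgamePerfect σ}

end Weih

/-!
Rank the outcomes by the lengths of the chains of strict preferences of player `a` below them. The
value of a history `w` is the greatest `j` such that player `a` wins the threshold game at `w`, in
which `a` has to reach an outcome of rank at least `j` from `w` on. The winning set of this game,
seen from `w`, arises from a set `v⁻¹(U)` with `U` an upper set by intersecting it with a cylinder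
and removing the prefix `w`. Hence `Win`, applied to all threshold games, yields the values, and
`Det` yields strategies for the winners.

Switching at every history to the strategy that is winning there may never amount to following any
of them. Instead, a player who has adopted a strategy keeps it until the value changes or the player
deviates from it. Along a play on which the player follows this rule, the value changes only in the
player's favour, hence finitely often, and from some point on the play is consistent with a single
winning strategy. So from each history of value `j`, player `a` secures rank at least `j` and player
`b` prevents rank at least `j + 1`, and no deviation pays off.
-/

namespace Weih

open Encodable

/-! ### Uniform computability -/

section OracleRec

theorem bind_pfun (x : Part ℕ) (f : ℕ →. ℕ) : (x >>= f) = x.bind f := rfl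

theorem mem_bind_pfun {x : Part ℕ} {f : ℕ →. ℕ} {y : ℕ} :
    y ∈ (x >>= f) ↔ ∃ b ∈ x, y ∈ f b :=
  Part.mem_bind_iff

theorem mem_seq_pair {x y : Part ℕ} {a : ℕ} :
    a ∈ (Nat.pair <$> x <*> y) ↔ ∃ b ∈ x, ∃ c ∈ y, Nat.pair b c = a := by
  simp [Seq.seq]

/-- Reassociation `((a, b), c) ↦ (a, (b, c))` of codes of nested pairs. -/
def pairAssoc (n : ℕ) : ℕ :=
  Nat.pair n.unpair.1.unpair.1 (Nat.pair n.unpair.1.unpair.2 n.unpair.2)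

/-- Reassociation `(a, (b, c)) ↦ ((a, b), c)` of codes of nested pairs. -/
def pairAssocSymm (n : ℕ) : ℕ :=
  Nat.pair (Nat.pair n.unpair.1 n.unpair.2.unpair.1) n.unpair.2.unpair.2

@[simp]
theorem pairAssoc_pair (a b c : ℕ) :
    pairAssoc (Nat.pair (Nat.pair a b) c) = Nat.pair a (Nat.pair b c) := by
  simp [pairAssoc]

@[simp]
theorem pairAssocSymm_pair (a b c : ℕ) :
    pairAssocSymm (Nat.pair a (Nat.pair b c)) = Nat.pair (Nat.pair a b) c := by
  simp [pairAssocSymm]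

theorem primrec_unpair_fst : Primrec fun n : ℕ => n.unpair.1 := Primrec.fst.comp Primrec.unpair

theorem primrec_unpair_snd : Primrec fun n : ℕ => n.unpair.2 := Primrec.snd.comp Primrec.unpair

theorem primrec_pairAssoc : Primrec pairAssoc :=
  Primrec₂.natPair.comp (primrec_unpair_fst.comp primrec_unpair_fst)
    (Primrec₂.natPair.comp (primrec_unpair_snd.comp primrec_unpair_fst) primrec_unpair_snd)

theorem primrec_pairAssocSymm : Primrec pairAssocSymm :=
  Primrec₂.natPair.comp
    (Primrec₂.natPair.comp primrec_unpair_fst (primrec_unpair_fst.comp primrec_unpair_snd))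
    (primrec_unpair_snd.comp primrec_unpair_snd)

namespace OracleRec

theorem of_eq {f g : Baire → ℕ →. ℕ} (hf : OracleRec f) (h : ∀ p n, f p n = g p n) :
    OracleRec g := by
  obtain rfl : f = g := funext fun p => funext (h p)
  exact hf

theorem id : OracleRec fun _ n => Part.some n :=
  (left.pair right).of_eq fun _ n => by simp [Seq.seq]

theorem of_partrec {f : ℕ →. ℕ} (hf : Nat.Partrec f) : OracleRec fun _ => f := by
  induction hf with
  | zero => exact zero
  | succ => exact succ
  | left => exact left
  | right => exact right
  | pair _ _ ihf ihg => exact ihf.pair ihg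
  | comp _ _ ihf ihg => exact ihf.comp ihg
  | prec _ _ ihf ihg => exact (ihf.prec ihg).of_eq fun _ n => by simp [Nat.unpaired]
  | rfind _ ihf => exact ihf.rfind

theorem comp_primrec {f : Baire → ℕ →. ℕ} (hf : OracleRec f) {g : ℕ → ℕ} (hg : Primrec g) :
    OracleRec fun p n => f p (g n) :=
  (hf.comp (of_partrec (Partrec.nat_iff.1 hg.to_comp))).of_eq fun _ _ => by
    rw [bind_pfun]
    exact Part.bind_some _ _

end OracleRec

/-- `Θ` computes what `Φ` computes relative to the oracles that `Ψ` computes uniformly in a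
parameter: the value of `Θ` at `(i, n)` is the value of `Φ` at `n` relative to `Ψ (i, ·)`. -/
def Substitutes (Ψ Φ Θ : Baire → ℕ →. ℕ) : Prop :=
  ∀ (p g : Baire) (i : ℕ), (∀ n, g n ∈ Ψ p (Nat.pair i n)) →
    ∀ n, ∀ y ∈ Φ g n, y ∈ Θ p (Nat.pair i n)

namespace Substitutes

variable {Ψ f F h H : Baire → ℕ →. ℕ}

theorem pair (hf : Substitutes Ψ f F) (hh : Substitutes Ψ h H) :
    Substitutes Ψ (fun p n => Nat.pair <$> f p n <*> h p n)
      (fun p n => Nat.pair <$> F p n <*> H p n) := by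
  intro p g i hg n y hy
  obtain ⟨b, hb, c, hc, rfl⟩ := mem_seq_pair.1 hy
  exact mem_seq_pair.2 ⟨b, hf p g i hg n b hb, c, hh p g i hg n c hc, rfl⟩

theorem comp (hf : Substitutes Ψ f F) (hh : Substitutes Ψ h H) :
    Substitutes Ψ (fun p n => h p n >>= f p)
      (fun p n => (Nat.pair <$> Part.some n.unpair.1 <*> H p n) >>= F p) := by
  intro p g i hg n y hy
  obtain ⟨b, hb, hy⟩ := mem_bind_pfun.1 hy
  exact mem_bind_pfun.2 ⟨Nat.pair i b, mem_seq_pair.2 ⟨i, by simp, b, hh p g i hg n b hb, rfl⟩,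
    hf p g i hg b y hy⟩

theorem prec (hf : Substitutes Ψ f F) (hh : Substitutes Ψ h H) :
    Substitutes Ψ
      (fun p m => m.unpair.2.rec (f p m.unpair.1) fun y IH =>
        IH >>= fun i => h p (Nat.pair m.unpair.1 (Nat.pair y i)))
      (fun p n => (pairAssocSymm n).unpair.2.rec (F p (pairAssocSymm n).unpair.1) fun y IH =>
        IH >>= fun i => H p (pairAssoc (Nat.pair (pairAssocSymm n).unpair.1 (Nat.pair y i)))) := by
  intro p g i hg n y hy
  obtain ⟨a, t, rfl⟩ : ∃ a t, n = Nat.pair a t := ⟨_, _, n.pair_unpair.symm⟩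
  simp only [pairAssocSymm_pair, pairAssoc_pair, Nat.unpair_pair] at hy ⊢
  induction t generalizing y with
  | zero => exact hf p g i hg a y hy
  | succ t ih =>
    simp only [Part.bind_eq_bind, Part.mem_bind_iff] at hy ⊢
    obtain ⟨b, hb, hy⟩ := hy
    exact ⟨b, ih b hb, hh p g i hg _ y hy⟩

theorem rfind (hf : Substitutes Ψ f F) :
    Substitutes Ψ
      (fun p a => Nat.rfind fun n => (fun m => decide (m = 0)) <$> f p (Nat.pair a n))
      (fun p a => Nat.rfind fun n =>
        (fun m => decide (m = 0)) <$> F p (pairAssoc (Nat.pair a n))) := by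
  intro p g i hg n y hy
  have lift {t : ℕ} {b : Bool} (hb : b ∈ (fun m => decide (m = 0)) <$> f g (Nat.pair n t)) :
      b ∈ (fun m => decide (m = 0)) <$> F p (pairAssoc (Nat.pair (Nat.pair i n) t)) := by
    obtain ⟨m, hm, hmb⟩ := (Part.mem_map_iff _).1 hb
    rw [pairAssoc_pair]
    exact (Part.mem_map_iff _).2 ⟨m, hf p g i hg _ m hm, hmb⟩
  obtain ⟨hzero, hpos⟩ := Nat.mem_rfind.1 hy
  exact Nat.mem_rfind.2 ⟨lift hzero, fun ht => lift (hpos ht)⟩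

end Substitutes

theorem OracleRec.exists_substitutes {Φ Ψ : Baire → ℕ →. ℕ} (hΦ : OracleRec Φ)
    (hΨ : OracleRec Ψ) : ∃ Θ, OracleRec Θ ∧ Substitutes Ψ Φ Θ := by
  induction hΦ with
  | zero => exact ⟨_, zero, fun _ _ _ _ _ _ hy => hy⟩
  | succ => exact ⟨_, succ.comp right, fun _ _ _ _ _ _ hy => by simpa using hy⟩
  | left => exact ⟨_, left.comp right, fun _ _ _ _ _ _ hy => by simpa using hy⟩
  | right => exact ⟨_, right.comp right, fun _ _ _ _ _ _ hy => by simpa using hy⟩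
  | oracle => exact ⟨_, hΨ, fun _ _ _ hg n _ hy => Part.mem_some_iff.1 hy ▸ hg n⟩
  | pair _ _ ihf ihh =>
    obtain ⟨⟨F, hF, hfF⟩, H, hH, hhH⟩ := And.intro ihf ihh
    exact ⟨_, hF.pair hH, hfF.pair hhH⟩
  | comp _ _ ihf ihh =>
    obtain ⟨⟨F, hF, hfF⟩, H, hH, hhH⟩ := And.intro ihf ihh
    exact ⟨_, hF.comp (left.pair hH), hfF.comp hhH⟩
  | prec _ _ ihf ihh =>
    obtain ⟨⟨F, hF, hfF⟩, H, hH, hhH⟩ := And.intro ihf ihh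
    exact ⟨_, (hF.prec (hH.comp_primrec primrec_pairAssoc)).comp_primrec primrec_pairAssocSymm,
      hfF.prec hhH⟩
  | rfind _ ihf =>
    obtain ⟨F, hF, hfF⟩ := ihf
    exact ⟨_, (hF.comp_primrec primrec_pairAssoc).rfind, hfF.rfind⟩

end OracleRec

/-- `f` is computable uniformly in its first argument: one oracle machine computes `f x` relative to
every name of `x`. -/
def UniformlyComputable {α β : Type} [Primcodable α] [Primcodable β] (X : RepSpace)
    (f : X.carrier → α → β) : Prop :=
  ∃ Φ, OracleRec Φ ∧ ∀ p x, X.names p x → ∀ a, encode (f x a) ∈ Φ p (encode a)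

namespace UniformlyComputable

variable {α β γ δ : Type} [Primcodable α] [Primcodable β] [Primcodable γ] [Primcodable δ]
  {X : RepSpace}

theorem of_primrec {g : α → β} (hg : Primrec g) : UniformlyComputable X fun _ => g :=
  ⟨_, OracleRec.of_partrec hg.to_comp, fun p x _ a => by simp⟩

theorem of_eq {f g : X.carrier → α → β} (hf : UniformlyComputable X f)
    (h : ∀ x a, f x a = g x a) : UniformlyComputable X g := by
  obtain rfl : f = g := funext fun x => funext (h x)
  exact hf

theorem of_encode {f : X.carrier → α → β} (hf : UniformlyComputable X fun x a => encode (f x a)) :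
    UniformlyComputable X f :=
  hf

theorem comp {g : X.carrier → β → γ} {f : X.carrier → α → β} (hg : UniformlyComputable X g)
    (hf : UniformlyComputable X f) : UniformlyComputable X fun x a => g x (f x a) := by
  obtain ⟨Φ, hΦ, hf⟩ := hf
  obtain ⟨Ψ, hΨ, hg⟩ := hg
  exact ⟨_, hΨ.comp hΦ, fun p x hp a => mem_bind_pfun.2 ⟨_, hf p x hp a, hg p x hp _⟩⟩

theorem mk {f : X.carrier → α → β} {g : X.carrier → α → γ} (hf : UniformlyComputable X f)
    (hg : UniformlyComputable X g) : UniformlyComputable X fun x a => (f x a, g x a) := by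
  obtain ⟨Φ, hΦ, hf⟩ := hf
  obtain ⟨Ψ, hΨ, hg⟩ := hg
  exact ⟨_, hΦ.pair hΨ, fun p x hp a => mem_seq_pair.2 ⟨_, hf p x hp a, _, hg p x hp a, rfl⟩⟩

theorem map {g : β → γ} (hg : Primrec g) {f : X.carrier → α → β} (hf : UniformlyComputable X f) :
    UniformlyComputable X fun x a => g (f x a) :=
  (of_primrec hg).comp hf

theorem map₂ {h : β → γ → δ} (hh : Primrec₂ h) {f : X.carrier → α → β} {g : X.carrier → α → γ}
    (hf : UniformlyComputable X f) (hg : UniformlyComputable X g) :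
    UniformlyComputable X fun x a => h (f x a) (g x a) :=
  (of_primrec hh).comp (hf.mk hg)

theorem id : UniformlyComputable X fun _ (a : α) => a := of_primrec Primrec.id

theorem const (b : β) : UniformlyComputable X fun _ (_ : α) => b := of_primrec (Primrec.const b)

theorem fst : UniformlyComputable X fun _ (a : α × β) => a.1 := of_primrec Primrec.fst

theorem snd : UniformlyComputable X fun _ (a : α × β) => a.2 := of_primrec Primrec.snd

theorem encoding {f : X.carrier → α → β} (hf : UniformlyComputable X f) :
    UniformlyComputable X fun x a => encode (f x a) :=
  map Primrec.encode hf

section Decidable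

variable {c e : X.carrier → α → Prop} [∀ x a, Decidable (c x a)] [∀ x a, Decidable (e x a)]

theorem decide_eq [DecidableEq β] {f g : X.carrier → α → β} (hf : UniformlyComputable X f)
    (hg : UniformlyComputable X g) : UniformlyComputable X fun x a => decide (f x a = g x a) :=
  map₂ Primrec.eq.decide hf hg

theorem decide_and (hc : UniformlyComputable X fun x a => decide (c x a))
    (he : UniformlyComputable X fun x a => decide (e x a)) :
    UniformlyComputable X fun x a => decide (c x a ∧ e x a) :=
  (map₂ Primrec.and hc he).of_eq fun _ _ => (Bool.decide_and _ _).symm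

theorem decide_imp (hc : UniformlyComputable X fun x a => decide (c x a))
    (he : UniformlyComputable X fun x a => decide (e x a)) :
    UniformlyComputable X fun x a => decide (c x a → e x a) :=
  (map₂ Primrec.or (map Primrec.not hc) he).of_eq fun _ _ => by simp [imp_iff_not_or]

theorem ite {f g : X.carrier → α → β} (hc : UniformlyComputable X fun x a => decide (c x a))
    (hf : UniformlyComputable X f) (hg : UniformlyComputable X g) :
    UniformlyComputable X fun x a => if c x a then f x a else g x a :=
  (map (Primrec.cond Primrec.fst (Primrec.fst.comp Primrec.snd) (Primrec.snd.comp Primrec.snd))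
    (hc.mk (hf.mk hg))).of_eq fun _ _ => Bool.cond_decide _ _ _

end Decidable

theorem nat_rec {f : X.carrier → α → ℕ} {g : X.carrier → α → β}
    {h : X.carrier → α × ℕ × β → β} (hf : UniformlyComputable X f) (hg : UniformlyComputable X g)
    (hh : UniformlyComputable X h) :
    UniformlyComputable X fun x a =>
      Nat.rec (motive := fun _ => β) (g x a) (fun y b => h x (a, y, b)) (f x a) := by
  obtain ⟨F, hF, hf⟩ := hf
  obtain ⟨G, hG, hg⟩ := hg
  obtain ⟨H, hH, hh⟩ := hh
  refine ⟨_, (hG.prec hH).comp (OracleRec.id.pair hF), fun p x hp a => mem_bind_pfun.2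
    ⟨Nat.pair (encode a) (f x a), mem_seq_pair.2 ⟨_, by simp, _, hf p x hp a, rfl⟩, ?_⟩⟩
  simp only [Nat.unpair_pair]
  induction f x a with
  | zero => exact hg p x hp a
  | succ t ih =>
    simp only [Part.bind_eq_bind, Part.mem_bind_iff]
    exact ⟨_, ih, hh p x hp (a, t, _)⟩

theorem rfind {f : X.carrier → α → ℕ} {g : X.carrier → α × ℕ → ℕ} (hg : UniformlyComputable X g)
    (h : ∀ x a n, g x (a, n) = 0 ↔ n = f x a) : UniformlyComputable X f := by
  obtain ⟨G, hG, hg⟩ := hg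
  refine ⟨_, hG.rfind, fun p x hp a => Nat.mem_rfind.2 ⟨?_, fun {m} hm => ?_⟩⟩
  · exact (Part.mem_map_iff _).2 ⟨_, hg p x hp (a, f x a), by simp [(h x a _).2]⟩
  · exact (Part.mem_map_iff _).2 ⟨_, hg p x hp (a, m), by simpa [h x a] using hm.ne⟩

theorem range_map {f : X.carrier → α → ℕ} {g : X.carrier → α × ℕ → β}
    (hf : UniformlyComputable X f) (hg : UniformlyComputable X g) :
    UniformlyComputable X fun x a => (List.range (f x a)).map fun n => g x (a, n) := by
  have step : UniformlyComputable X fun x (y : α × ℕ × List β) => y.2.2 ++ [g x (y.1, y.2.1)] :=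
    map₂ Primrec.list_concat (snd.comp snd) (hg.comp (fst.mk (fst.comp snd)))
  refine (hf.nat_rec (const []) step).of_eq fun x a => ?_
  induction f x a with
  | zero => rfl
  | succ t ih => rw [List.range_succ, List.map_append, ← ih]; rfl

theorem range_any {f : X.carrier → α → ℕ} {g : X.carrier → α × ℕ → Bool}
    (hf : UniformlyComputable X f) (hg : UniformlyComputable X g) :
    UniformlyComputable X fun x a => (List.range (f x a)).any fun n => g x (a, n) := by
  have step : UniformlyComputable X fun x (y : α × ℕ × Bool) => y.2.2 || g x (y.1, y.2.1) :=
    map₂ Primrec.or (snd.comp snd) (hg.comp (fst.mk (fst.comp snd)))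
  refine (hf.nat_rec (const false) step).of_eq fun x a => ?_
  induction f x a with
  | zero => rfl
  | succ t ih => simp [List.range_succ, ← ih]

theorem findGreatest {c : X.carrier → α → ℕ → Prop} [∀ x a, DecidablePred (c x a)]
    {f : X.carrier → α → ℕ} (hf : UniformlyComputable X f)
    (hc : UniformlyComputable X fun x (y : α × ℕ) => decide (c x y.1 y.2)) :
    UniformlyComputable X fun x a => Nat.findGreatest (c x a) (f x a) := by
  have hsucc : UniformlyComputable X fun _ (y : α × ℕ × ℕ) => y.2.1 + 1 :=
    map Primrec.succ (fst.comp snd)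
  have step := ite (c := fun x (y : α × ℕ × ℕ) => c x y.1 (y.2.1 + 1))
    (hc.comp (fst.mk hsucc)) hsucc (snd.comp snd)
  refine (hf.nat_rec (const 0) step).of_eq fun x a => ?_
  induction f x a with
  | zero => rfl
  | succ t ih => rw [Nat.findGreatest_succ, ← ih]

theorem reverseRecOn [Inhabited β] {g : X.carrier → α → List β} {z : X.carrier → α → γ}
    {h : X.carrier → α × List β × β × γ → γ} (hg : UniformlyComputable X g)
    (hz : UniformlyComputable X z) (hh : UniformlyComputable X h) :
    UniformlyComputable X fun x a => List.reverseRecOn (motive := fun _ => γ) (g x a) (z x a)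
      fun u b r => h x (a, u, b, r) := by
  have step : UniformlyComputable X fun x (y : α × ℕ × γ) =>
      h x (y.1, (g x y.1).take y.2.1, (g x y.1).getD y.2.1 default, y.2.2) := by
    have hgx : UniformlyComputable X fun x (y : α × ℕ × γ) => g x y.1 := hg.comp fst
    have hn : UniformlyComputable X fun _ (y : α × ℕ × γ) => y.2.1 := fst.comp snd
    exact hh.comp (fst.mk ((map₂ Primrec.list_take hn hgx).mk
      ((map₂ (Primrec.list_getD default) hgx hn).mk (snd.comp snd))))
  refine ((map Primrec.list_length hg).nat_rec hz step).of_eq fun x a => ?_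
  suffices ∀ m ≤ (g x a).length, Nat.rec (motive := fun _ => γ) (z x a)
      (fun n r => h x (a, (g x a).take n, (g x a).getD n default, r)) m =
        List.reverseRecOn (motive := fun _ => γ) ((g x a).take m) (z x a)
          fun u b r => h x (a, u, b, r) by
    simpa only [List.take_length] using this _ le_rfl
  intro m hm
  induction m with
  | zero => simp
  | succ m ih =>
    simp only [List.take_succ_eq_append_getElem hm, List.reverseRecOn_concat, ← ih (by omega),
      List.getD_eq_getElem _ _ hm]

end UniformlyComputable

/-- The represented space of the points of `X` that are equipped with one of their names. It makes
names accessible to uniformly computable functions. -/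
def RepSpace.named (X : RepSpace) : RepSpace where
  carrier := {z : Baire × X.carrier // X.names z.1 z.2}
  names p z := p = z.1.1
  functional := by
    rintro p ⟨⟨_, x⟩, hx⟩ ⟨⟨_, y⟩, hy⟩ rfl rfl
    obtain rfl := X.functional _ x y hx hy
    rfl
  surjective z := ⟨z.1.1, rfl⟩

namespace UniformlyComputable

variable {α β : Type} [Primcodable α] [Primcodable β] {X : RepSpace}

theorem named {f : X.carrier → α → β} (hf : UniformlyComputable X f) :
    UniformlyComputable X.named fun z => f z.1.2 := by
  obtain ⟨Φ, hΦ, hf⟩ := hf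
  refine ⟨Φ, hΦ, fun p z hz => ?_⟩
  obtain rfl : p = z.1.1 := hz
  exact hf _ _ z.2

theorem of_named {f : X.carrier → α → β} {F : X.named.carrier → α → β}
    (hF : UniformlyComputable X.named F) (h : ∀ z a, F z a = f z.1.2 a) :
    UniformlyComputable X f := by
  obtain ⟨Φ, hΦ, hF⟩ := hF
  exact ⟨Φ, hΦ, fun p x hx a => h ⟨(p, x), hx⟩ a ▸ hF p ⟨(p, x), hx⟩ rfl a⟩

theorem query {f : X.named.carrier → α → ℕ} (hf : UniformlyComputable X.named f) :
    UniformlyComputable X.named fun z a => z.1.1 (f z a) :=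
  comp (X := X.named) (g := fun z n => z.1.1 n)
    ⟨_, OracleRec.oracle, fun _ _ hz _ => Part.mem_some_iff.2 (congrFun hz.symm _)⟩ hf

end UniformlyComputable

/-- `f` is a computable family, indexed by `α`, of maps between represented spaces: names of
`f x a` are computable from the names of `x`, uniformly in `a`. -/
def ComputableMap {α : Type} [Primcodable α] (X Y : RepSpace) (f : X.carrier → α → Y.carrier) :
    Prop :=
  ∃ N : X.named.carrier → α → Baire,
    UniformlyComputable X.named (fun z (a : α × ℕ) => N z a.1 a.2) ∧
      ∀ z a, Y.names (N z a) (f z.1.2 a)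

namespace ComputableMap

variable {α β : Type} [Primcodable α] [Primcodable β] {X Y Z : RepSpace}

theorem id : ComputableMap X X fun x (_ : α) => x :=
  ⟨fun z _ => z.1.1, UniformlyComputable.query UniformlyComputable.snd, fun z _ => z.2⟩

theorem reindex {f : X.carrier → β → Y.carrier} (hf : ComputableMap X Y f)
    {g : X.carrier → α → β} (hg : UniformlyComputable X g) :
    ComputableMap X Y fun x a => f x (g x a) := by
  obtain ⟨N, hN, hf⟩ := hf
  exact ⟨fun z a => N z (g z.1.2 a), hN.comp
    ((hg.named.comp UniformlyComputable.fst).mk UniformlyComputable.snd), fun z a => hf z _⟩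

theorem discrete {f : X.carrier → α → β} (hf : UniformlyComputable X f) :
    ComputableMap X (discreteSpace β) f :=
  ⟨fun z a => natName (encode (f z.1.2 a)),
    .ite (.decide_eq .snd (hf.named.encoding.comp .fst)) (.const 1) (.const 0), fun _ _ => rfl⟩

theorem toUniformlyComputable {f : X.carrier → α → β}
    (hf : ComputableMap X (discreteSpace β) f) : UniformlyComputable X f := by
  obtain ⟨N, hN, hf⟩ := hf
  have hone : ∀ z a n, (if N z a n = 1 then 0 else 1) = 0 ↔ n = encode (f z.1.2 a) := by
    intro z a n
    rw [show N z a = natName (encode (f z.1.2 a)) from hf z a]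
    simp [natName]
  exact .of_encode (.of_named (.rfind (.ite (.decide_eq hN (.const 1)) (.const 0) (.const 1)) hone)
    fun _ _ => rfl)

theorem mk {f : X.carrier → α → Y.carrier} {g : X.carrier → α → Z.carrier}
    (hf : ComputableMap X Y f) (hg : ComputableMap X Z g) :
    ComputableMap X (prodSpace Y Z) fun x a => (f x a, g x a) := by
  obtain ⟨N, hN, hf⟩ := hf
  obtain ⟨M, hM, hg⟩ := hg
  have half : UniformlyComputable X.named fun _ (a : α × ℕ) => (a.1, a.2.div2) :=
    .mk .fst (.map Primrec.nat_div2 .snd)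
  refine ⟨fun z a => pair (N z a) (M z a), ?_, fun z a => ?_⟩
  · exact (UniformlyComputable.ite (.decide_eq (.map Primrec.nat_bodd .snd) (.const true))
      (hM.comp half) (hN.comp half)).of_eq fun z a => by cases h : a.2.bodd <;> simp [pair, h]
  · exact ⟨(fstB_pair _ _).symm ▸ hf z a, (sndB_pair _ _).symm ▸ hg z a⟩

theorem fst {f : X.carrier → α → Y.carrier × Z.carrier} (hf : ComputableMap X (prodSpace Y Z) f) :
    ComputableMap X Y fun x a => (f x a).1 := by
  obtain ⟨N, hN, hf⟩ := hf
  exact ⟨fun z a => fstB (N z a), hN.comp (.mk .fst (.map Primrec.nat_double .snd)),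
    fun z a => (hf z a).1⟩

theorem snd {f : X.carrier → α → Y.carrier × Z.carrier} (hf : ComputableMap X (prodSpace Y Z) f) :
    ComputableMap X Z fun x a => (f x a).2 := by
  obtain ⟨N, hN, hf⟩ := hf
  exact ⟨fun z a => sndB (N z a), hN.comp (.mk .fst (.map Primrec.nat_double_succ .snd)),
    fun z a => (hf z a).2⟩

theorem seq {f : X.carrier → α → ℕ → Y.carrier}
    (hf : ComputableMap X Y fun x (a : α × ℕ) => f x a.1 a.2) :
    ComputableMap X (seqSpace Y) f := by
  obtain ⟨N, hN, hf⟩ := hf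
  have hunpair : UniformlyComputable X.named fun _ (a : α × ℕ) =>
      ((a.1, a.2.unpair.1), a.2.unpair.2) :=
    .mk (.mk .fst (.map primrec_unpair_fst .snd)) (.map primrec_unpair_snd .snd)
  exact ⟨fun z a => join fun i => N z (a, i), hN.comp hunpair,
    fun z a i => (sect_join _ i).symm ▸ hf z (a, i)⟩

theorem coordinate {f : X.carrier → α → ℕ → Y.carrier} (hf : ComputableMap X (seqSpace Y) f) :
    ComputableMap X Y fun x (a : α × ℕ) => f x a.1 a.2 := by
  obtain ⟨N, hN, hf⟩ := hf
  exact ⟨fun z a => sect (N z a.1) a.2,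
    hN.comp (.mk (.comp .fst .fst) (.map₂ Primrec₂.natPair (.comp .snd .fst) .snd)),
    fun z a => hf z a.1 a.2⟩

theorem table {f : X.carrier → α → List Bool → β}
    (hf : UniformlyComputable X fun x (a : α × List Bool) => f x a.1 a.2) :
    ComputableMap X (tableSpace β) f := by
  have hdecode : UniformlyComputable X.named fun _ (n : ℕ) => ((decode n).getD [] : List Bool) :=
    .of_primrec (Primrec.option_getD.comp Primrec.decode (Primrec.const _))
  exact ⟨fun z a n => encode (f z.1.2 a ((decode n).getD [])),
    (hf.named.comp (.mk .fst (hdecode.comp .snd))).encoding, fun z a w => by simp⟩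

theorem lookUp {f : X.carrier → α → List Bool → β} (hf : ComputableMap X (tableSpace β) f) :
    UniformlyComputable X fun x (a : α × List Bool) => f x a.1 a.2 := by
  obtain ⟨N, hN, hf⟩ := hf
  exact .of_encode (.of_named (hN.comp (.mk .fst (.encoding .snd))) fun z a => hf z a.1 a.2)

theorem realize {f : MultiFun Y Z} (hf : f.IsComputable) {g : X.carrier → α → Y.carrier}
    {h : X.carrier → α → Z.carrier} (hg : ComputableMap X Y g) (hdom : ∀ x a, g x a ∈ f.dom)
    (hval : ∀ x a, ∀ y ∈ f.val (g x a), y = h x a) : ComputableMap X Z h := by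
  obtain ⟨F, ⟨Φ, hΦ, hF⟩, hreal⟩ := hf
  obtain ⟨N, ⟨Ψ, hΨ, hN⟩, hNg⟩ := hg
  obtain ⟨Θ, hΘ, hsubst⟩ := hΦ.exists_substitutes hΨ
  have hname : ∀ z a, ∃ q ∈ F (N z a), Z.names q (h z.1.2 a) := by
    intro z a
    obtain ⟨q, hq, y, hy, hqy⟩ := hreal _ _ (hNg z a) (hdom _ _)
    exact ⟨q, hq, hval _ _ y hy ▸ hqy⟩
  choose M hM hMh using hname
  exact ⟨M, ⟨Θ, hΘ, fun p z hz a =>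
    hsubst p _ _ (fun n => hN p z hz (a.1, n)) _ _ (hF _ _ (hM z a.1) a.2)⟩, hMh⟩

theorem comp_uniformlyComputable {γ : Type} [Primcodable γ] {g : Y.carrier → β → γ}
    {f : X.carrier → Y.carrier} (hf : ComputableMap X Y fun x (_ : Unit) => f x)
    (hg : UniformlyComputable Y g) : UniformlyComputable X fun x => g (f x) := by
  obtain ⟨Φ, hΦ, hg⟩ := hg
  obtain ⟨N, ⟨Ψ, hΨ, hN⟩, hNf⟩ := hf
  obtain ⟨Θ, hΘ, hsubst⟩ := hΦ.exists_substitutes hΨ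
  exact ⟨_, hΘ.comp_primrec (Primrec₂.natPair.comp (Primrec.const 0) Primrec.id),
    fun p x hx a => hsubst p _ 0 (fun n => hN p ⟨(p, x), hx⟩ rfl ((), n)) _ _
      (hg _ _ (hNf ⟨(p, x), hx⟩ ()) a)⟩

theorem exists_computableFun {f : X.carrier → Y.carrier}
    (hf : ComputableMap X Y fun x (_ : Unit) => f x) :
    ∃ F, ComputableFun F ∧ ∀ p x, X.names p x → ∃ q ∈ F p, Y.names q (f x) := by
  obtain ⟨N, ⟨Φ, hΦ, hN⟩, hf⟩ := hf
  have hvalue : ∀ p x, X.names p x → ∃ q, Y.names q (f x) ∧ ∀ n, q n ∈ Φ p (Nat.pair 0 n) :=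
    fun p x hx => ⟨_, hf ⟨(p, x), hx⟩ (), fun n => hN p ⟨(p, x), hx⟩ rfl ((), n)⟩
  refine ⟨fun p => ⟨∀ n, (Φ p (Nat.pair 0 n)).Dom, fun h n => (Φ p (Nat.pair 0 n)).get (h n)⟩,
    ⟨_, hΦ.comp_primrec (Primrec₂.natPair.comp (Primrec.const 0) Primrec.id), ?_⟩, ?_⟩
  · rintro p q ⟨hdom, rfl⟩ n
    exact ⟨hdom n, rfl⟩
  · intro p x hx
    obtain ⟨q, hq, hqΦ⟩ := hvalue p x hx
    exact ⟨q, ⟨fun n => (hqΦ n).1, funext fun n => (hqΦ n).2⟩, hq⟩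

end ComputableMap

theorem weihrauchReducible_of_computableMap {X Y Z W : RepSpace} {f : MultiFun X Y}
    {g : MultiFun Z W} {h : X.carrier → Z.carrier} {k : X.carrier × W.carrier → Y.carrier}
    (hh : ComputableMap X Z fun x (_ : Unit) => h x)
    (hk : ComputableMap (prodSpace X W) Y fun z (_ : Unit) => k z)
    (hdom : ∀ x ∈ f.dom, h x ∈ g.dom)
    (hval : ∀ x ∈ f.dom, ∀ y ∈ g.val (h x), k (x, y) ∈ f.val x) : WeihrauchReducible f g := by
  obtain ⟨H, hH, hHh⟩ := hh.exists_computableFun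
  obtain ⟨K, hK, hKk⟩ := hk.exists_computableFun
  refine ⟨K, H, hK, hH, fun G hG p x hx hxf => ?_⟩
  obtain ⟨r, hr, hrx⟩ := hHh p x hx
  obtain ⟨q, hq, y, hy, hqy⟩ := hG r _ hrx (hdom x hxf)
  obtain ⟨s, hs, hsk⟩ := hKk (pair p q) (x, y)
    ⟨(fstB_pair p q).symm ▸ hx, (sndB_pair p q).symm ▸ hqy⟩
  exact ⟨s, Part.mem_bind hr (Part.mem_bind hq hs), _, hval x hxf y hy, hsk⟩

/-! ### Plays and winning strategies -/

section Plays

variable {A C : Type}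

/-- The word of the first `n` entries of `x`. -/
def initSeg (x : ℕ → C) (n : ℕ) : List C := (List.range n).map x

@[simp]
theorem length_initSeg (x : ℕ → C) (n : ℕ) : (initSeg x n).length = n := by simp [initSeg]

@[simp]
theorem initSeg_zero (x : ℕ → C) : initSeg x 0 = [] := rfl

theorem initSeg_succ (x : ℕ → C) (n : ℕ) : initSeg x (n + 1) = initSeg x n ++ [x n] := by
  simp [initSeg, List.range_succ]

theorem initSeg_inj_left {x y : ℕ → C} {n : ℕ} :
    initSeg x n = initSeg y n ↔ ∀ m < n, x m = y m := by
  simp [initSeg, List.map_inj_left]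

theorem take_initSeg (x : ℕ → C) {m n : ℕ} (h : m ≤ n) : (initSeg x n).take m = initSeg x m := by
  rw [initSeg, ← List.map_take, List.take_range, min_eq_left h, initSeg]

theorem initSeg_prefix (x : ℕ → C) {m n : ℕ} (h : m ≤ n) : initSeg x m <+: initSeg x n :=
  take_initSeg x h ▸ List.take_prefix m _

theorem initSeg_length_of_prefix {x : ℕ → C} {u : List C} {n : ℕ} (h : u <+: initSeg x n) :
    initSeg x u.length = u := by
  rw [← take_initSeg x (length_initSeg x n ▸ h.length_le)]
  exact (List.prefix_iff_eq_take.1 h).symm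

theorem initSeg_length_eq_iff {x : ℕ → C} {l : List C} :
    initSeg x l.length = l ↔ ∀ m (h : m < l.length), x m = l[m] := by
  refine ⟨fun h m hm => ?_, fun h => List.ext_getElem (by simp) fun m _ hm => ?_⟩
  · have : (initSeg x l.length)[m]? = l[m]? := by rw [h]
    simpa [initSeg, hm] using this
  · simpa [initSeg] using h m hm

theorem initSeg_play (σ : List C → C) (l : List C) : initSeg (play σ l) l.length = l :=
  initSeg_length_eq_iff.2 fun _ h => by simp [play, h]

theorem initSeg_play_add (σ : List C → C) (l : List C) (n : ℕ) :
    initSeg (play σ l) (l.length + n) = history σ l n := by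
  induction n with
  | zero => exact initSeg_play σ l
  | succ n ih =>
    rw [← add_assoc, initSeg_succ, ih]
    simp [play, history]

theorem play_apply (σ : List C → C) (l : List C) {n : ℕ} (h : l.length ≤ n) :
    play σ l n = σ (initSeg (play σ l) n) := by
  obtain ⟨m, rfl⟩ := Nat.exists_eq_add_of_le h
  rw [initSeg_play_add]
  simp [play]

theorem play_eq {σ : List C → C} {l : List C} {x : ℕ → C} (hl : initSeg x l.length = l)
    (hx : ∀ n, l.length ≤ n → x n = σ (initSeg x n)) : play σ l = x := by
  funext n
  induction n using Nat.strong_induction_on with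
  | _ n ih =>
    rcases lt_or_ge n l.length with hn | hn
    · exact initSeg_inj_left.1 ((initSeg_play σ l).trans hl.symm) n hn
    · rw [play_apply σ l hn, hx n hn, initSeg_inj_left.2 ih]

theorem prepend_length_add (l : List Bool) (y : Cantor) (n : ℕ) :
    prepend l y (l.length + n) = y n := by
  simp [prepend]

theorem prepend_injective (l : List Bool) : Function.Injective (prepend l) := fun x y h =>
  funext fun n => by rw [← prepend_length_add l x, h, prepend_length_add]

theorem initSeg_prepend (l : List Bool) (y : Cantor) (n : ℕ) :
    initSeg (prepend l y) (l.length + n) = l ++ initSeg y n := by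
  induction n with
  | zero => simpa using initSeg_length_eq_iff.2 fun m hm => by simp [prepend, hm]
  | succ n ih =>
    rw [← add_assoc, initSeg_succ, ih, prepend_length_add, initSeg_succ, List.append_assoc]

theorem prepend_tail_eq {x : Cantor} {l : List Bool} (h : initSeg x l.length = l) :
    prepend l (fun n => x (l.length + n)) = x := by
  funext n
  rcases lt_or_ge n l.length with hn | hn
  · simp [prepend, hn, initSeg_length_eq_iff.1 h n hn]
  · obtain ⟨m, rfl⟩ := Nat.exists_eq_add_of_le hn
    rw [prepend_length_add]

/-- The play `x` passes through the history `l`, and agent `i` follows the strategy `s` from there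
on. -/
def Follows (d : List C → A) (i : A) (s : List C → C) (l : List C) (x : ℕ → C) : Prop :=
  initSeg x l.length = l ∧ ∀ n, l.length ≤ n → d (initSeg x n) = i → x n = s (initSeg x n)

/-- Agent `i` enforces from the history `l` on that the play is in `S` by following `s`. -/
def Winning (d : List C → A) (i : A) (s : List C → C) (l : List C) (S : Set (ℕ → C)) : Prop :=
  ∀ x, Follows d i s l x → x ∈ S

section Winning

variable {d : List C → A} {i j : A} {s t : List C → C} {l : List C} {S T : Set (ℕ → C)}

theorem follows_play {σ : List C → C} (hσ : ∀ w, d w = i → σ w = s w) :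
    Follows d i s l (play σ l) :=
  ⟨initSeg_play σ l, fun _ hn hd => (play_apply σ l hn).trans (hσ _ hd)⟩

theorem Follows.exists_play_eq {x : ℕ → C} (hx : Follows d i s l x) :
    ∃ σ : List C → C, (∀ w, d w = i → σ w = s w) ∧ play σ l = x := by
  classical
  refine ⟨fun w => if d w = i then s w else x w.length, fun w hw => if_pos hw,
    play_eq hx.1 fun n hn => ?_⟩
  by_cases hd : d (initSeg x n) = i
  · rw [if_pos hd, hx.2 n hn hd]
  · rw [if_neg hd, length_initSeg]

theorem Winning.play_mem (h : Winning d i s l S) {σ : List C → C}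
    (hσ : ∀ w, d w = i → σ w = s w) : play σ l ∈ S :=
  h _ (follows_play hσ)

theorem winning_of_play (h : ∀ σ : List C → C, (∀ w, d w = i → σ w = s w) → play σ l ∈ S) :
    Winning d i s l S := by
  intro x hx
  obtain ⟨σ, hσ, rfl⟩ := hx.exists_play_eq
  exact h σ hσ

theorem Winning.mono (h : Winning d i s l S) (hST : S ⊆ T) : Winning d i s l T :=
  fun x hx => hST (h x hx)

theorem Winning.congr (h : Winning d i s l S) (hst : ∀ w, d w = i → t w = s w) :
    Winning d i t l S :=
  winning_of_play fun _ hσ => h.play_mem fun w hw => (hσ w hw).trans (hst w hw)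

theorem Winning.inter_nonempty (hs : Winning d i s l S) (ht : Winning d j t l T) (hij : i ≠ j) :
    (S ∩ T).Nonempty := by
  classical
  exact ⟨play (fun w => if d w = i then s w else t w) l, hs.play_mem fun w hw => if_pos hw,
    ht.play_mem fun w hw => if_neg (hw.trans_ne hij.symm)⟩

theorem Winning.of_prefix {r w : List C} (h : Winning d i s r S) (hrw : r <+: w)
    (hmoves : ∀ u b, r <+: u → u ++ [b] <+: w → d u = i → b = s u) : Winning d i s w S := by
  rintro x ⟨hxw, hx⟩
  have hr : initSeg x r.length = r := initSeg_length_of_prefix (hxw.symm ▸ hrw)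
  refine h x ⟨hr, fun n hn hd => ?_⟩
  rcases le_or_gt w.length n with hwn | hnw
  · exact hx n hwn hd
  · refine hmoves _ _ (hr ▸ initSeg_prefix x hn) ?_ hd
    rw [← initSeg_succ, ← hxw]
    exact initSeg_prefix x hnw

theorem Winning.concat (h : Winning d i s l S) {b : C} (hb : d l = i → b = s l) :
    Winning d i s (l ++ [b]) S := by
  refine h.of_prefix (List.prefix_append _ _) fun u c hlu huc => ?_
  obtain ⟨rfl, rfl⟩ : u = l ∧ c = b := by
    have hle : u.length ≤ l.length := by simpa using huc.length_le
    obtain rfl : l = u := hlu.eq_of_length_le hle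
    simpa using huc.eq_of_length (by simp)
  exact hb

theorem Winning.shift {d : List Bool → A} {s : List Bool → Bool} {l : List Bool} {S : Set Cantor}
    (h : Winning (fun u => d (l ++ u)) i s [] (prepend l ⁻¹' S)) :
    Winning d i (fun w => s (w.drop l.length)) l S := by
  rintro x ⟨hl, hx⟩
  obtain ⟨y, rfl⟩ : ∃ y, x = prepend l y := ⟨_, (prepend_tail_eq hl).symm⟩
  refine h y ⟨rfl, fun n _ hd => ?_⟩
  simpa only [prepend_length_add, initSeg_prepend, List.drop_left] using
    hx (l.length + n) (Nat.le_add_right _ _) (by rwa [initSeg_prepend])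

end Winning

end Plays

section WinLose

/-- The plays that player `i` wins in the win/lose game with winning set `W` of player `0`. -/
def winSet {X : Type} (i : Fin 2) (W : Set X) : Set X := if i = 0 then W else Wᶜ

theorem preimage_winSet {X Y : Type} (f : X → Y) (i : Fin 2) (W : Set Y) :
    f ⁻¹' winSet i W = winSet i (f ⁻¹' W) := by
  unfold winSet
  split_ifs <;> rfl

theorem disjoint_winSet {X : Type} {i j : Fin 2} (hij : i ≠ j) (W : Set X) :
    Disjoint (winSet i W) (winSet j W) := by
  fin_cases i <;> fin_cases j <;>
    first | exact absurd rfl hij | simp [winSet, disjoint_compl_right, disjoint_compl_left]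

theorem Winning.winner_unique {C : Type} {d : List C → Fin 2} {i j : Fin 2} {s t : List C → C}
    {l : List C} {W : Set (ℕ → C)} (hs : Winning d i s l (winSet i W))
    (ht : Winning d j t l (winSet j W)) : i = j := by
  by_contra hij
  exact Set.not_disjoint_iff_nonempty_inter.2 (hs.inter_nonempty ht hij) (disjoint_winSet hij W)

variable {d : List Bool → Fin 2} {W : Set Cantor} {i : Fin 2} {σ : List Bool → Bool}

theorem outcome_winLose_eq_iff {l : List Bool} :
    (winLose d W).outcome σ l = i ↔ play σ l ∈ winSet i W := by
  fin_cases i <;> by_cases hx : play σ l ∈ W <;> simp [SeqGame.outcome, winLose, winSet, hx]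

theorem outcome_eq_of_isNash (hi : HasWinningStrategy d W i) (hσ : (winLose d W).IsNash σ) :
    (winLose d W).outcome σ [] = i := by
  obtain ⟨s, hs⟩ := hi
  by_contra hne
  exact hσ i (fun w => if d w = i then s w else σ w) (fun _ hw => if_neg hw)
    ⟨hne, hs _ fun _ hw => if_pos hw⟩

theorem winning_of_isNash (hi : HasWinningStrategy d W i) (hσ : (winLose d W).IsNash σ) :
    Winning d i σ [] (winSet i W) := by
  have hout := outcome_eq_of_isNash hi hσ
  refine winning_of_play fun τ hτ => (outcome_winLose_eq_iff (d := d)).1 ?_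
  by_contra hne
  refine hσ ((winLose d W).outcome τ []) τ (fun w hw => hτ w ?_) ⟨hout.trans_ne (Ne.symm hne), rfl⟩
  have other : ∀ a b c : Fin 2, a ≠ b → c ≠ b → a = c := by decide
  exact other _ _ _ hw (Ne.symm hne)

end WinLose

section Anchor

variable {A C V : Type} [DecidableEq A] [DecidableEq C] [DecidableEq V] {d : List C → A}
  {val : List C → V} {s : List C → List C → C} {i : A}

/-- The prefix of `w` at which agent `i` has adopted the strategy that is in force at `w`, where
`s r` is the strategy that is available at the history `r`: a new strategy is adopted whenever the
value changes, and whenever `i` deviates from the strategy in force. -/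
def anchor (d : List C → A) (val : List C → V) (s : List C → List C → C) (i : A) (w : List C) :
    List C :=
  List.reverseRecOn (motive := fun _ => List C) w [] fun u b r =>
    if val (u ++ [b]) = val u ∧ (d u = i → b = s r u) then r else u ++ [b]

/-- The strategy of agent `i` that always follows the strategy in force. -/
def inForce (d : List C → A) (val : List C → V) (s : List C → List C → C) (i : A) (w : List C) :
    C :=
  s (anchor d val s i w) w

theorem anchor_concat (u : List C) (b : C) :
    anchor d val s i (u ++ [b]) =
      if val (u ++ [b]) = val u ∧ (d u = i → b = inForce d val s i u)
      then anchor d val s i u else u ++ [b] := by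
  rw [anchor, List.reverseRecOn_concat]
  rfl

theorem anchor_prefix (w : List C) : anchor d val s i w <+: w := by
  induction w using List.reverseRecOn with
  | nil => rw [anchor, List.reverseRecOn_nil]
  | append_singleton u b ih =>
    rw [anchor_concat]
    split_ifs
    · exact ih.trans (List.prefix_append _ _)
    · exact List.prefix_rfl

theorem val_anchor (w : List C) : val (anchor d val s i w) = val w := by
  induction w using List.reverseRecOn with
  | nil => rw [List.prefix_nil.1 (anchor_prefix [])]
  | append_singleton u b ih =>
    rw [anchor_concat]
    split_ifs with h
    · exact ih.trans h.1.symm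
    · rfl

theorem eq_of_anchor_prefix (w : List C) {u : List C} {b : C} (hu : anchor d val s i w <+: u)
    (hub : u ++ [b] <+: w) (hd : d u = i) : b = s (anchor d val s i w) u := by
  induction w using List.reverseRecOn with
  | nil => simp at hub
  | append_singleton v c ih =>
    rw [anchor_concat] at hu ⊢
    split_ifs at hu ⊢ with h
    · rcases List.prefix_concat_iff.1 hub with heq | hub
      · obtain ⟨rfl, rfl⟩ : u = v ∧ b = c := by simpa using heq
        exact h.2 hd
      · exact ih hu hub
    · have hlen := (hub.trans hu).length_le
      simp at hlen

theorem winning_anchor {T : V → Set (ℕ → C)} (hs : ∀ l, Winning d i (s l) l (T (val l)))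
    (w : List C) : Winning d i (s (anchor d val s i w)) w (T (val w)) := by
  have hwin := hs (anchor d val s i w)
  rw [val_anchor (val := val)] at hwin
  exact hwin.of_prefix (anchor_prefix w) fun _ _ => eq_of_anchor_prefix w

theorem anchor_initSeg_eventually {x : ℕ → C} {N : ℕ}
    (hval : ∀ n, N ≤ n → val (initSeg x n) = val (initSeg x N))
    (hx : ∀ n, N ≤ n → d (initSeg x n) = i → x n = inForce d val s i (initSeg x n)) {n : ℕ}
    (hn : N ≤ n) : anchor d val s i (initSeg x n) = anchor d val s i (initSeg x N) := by
  induction n, hn using Nat.le_induction with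
  | base => rfl
  | succ n hn ih =>
    rw [initSeg_succ, anchor_concat, ← initSeg_succ, if_pos, ih]
    exact ⟨(hval _ (hn.trans n.le_succ)).trans (hval n hn).symm, hx n hn⟩

variable [PartialOrder V] {T : V → Set (ℕ → C)}

theorem Follows.val_monotone {l : List C} {x : ℕ → C}
    (hx : Follows d i (inForce d val s i) l x) (hs : ∀ l, Winning d i (s l) l (T (val l)))
    (hbest : ∀ t l l', Winning d i t l (T (val l')) → val l' ≤ val l) {m n : ℕ}
    (hm : l.length ≤ m) (hmn : m ≤ n) : val (initSeg x m) ≤ val (initSeg x n) := by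
  induction n, hmn using Nat.le_induction with
  | base => exact le_rfl
  | succ n hmn ih =>
    refine ih.trans (hbest (s (anchor d val s i (initSeg x n))) _ _ ?_)
    rw [initSeg_succ]
    exact (winning_anchor hs _).concat (hx.2 n (hm.trans hmn))

-- Along a play that follows `inForce`, the value can only increase, so it is eventually constant.
-- From then on the anchor does not move any more, and the agent sticks to one winning strategy.
theorem winning_inForce (hT : Antitone T) (hwf : WellFounded fun w w' => val w' < val w)
    (hs : ∀ l, Winning d i (s l) l (T (val l)))
    (hbest : ∀ t l l', Winning d i t l (T (val l')) → val l' ≤ val l) (l : List C) :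
    Winning d i (inForce d val s i) l (T (val l)) := by
  intro x hx
  obtain ⟨_, ⟨N, hN, rfl⟩, hmax⟩ :=
    hwf.has_min (initSeg x '' Set.Ici l.length) ⟨_, _, Set.self_mem_Ici, rfl⟩
  have hconst : ∀ n, N ≤ n → val (initSeg x n) = val (initSeg x N) := fun n hn =>
    ((hx.val_monotone hs hbest hN hn).eq_of_not_lt
      (hmax _ ⟨n, le_trans (Set.mem_Ici.1 hN) hn, rfl⟩)).symm
  have hmoves : ∀ n, N ≤ n → d (initSeg x n) = i → x n = inForce d val s i (initSeg x n) :=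
    fun n hn => hx.2 n (le_trans (Set.mem_Ici.1 hN) hn)
  have hle : val l ≤ val (initSeg x N) := by
    simpa only [hx.1] using hx.val_monotone hs hbest le_rfl hN
  refine hT hle (winning_anchor hs (initSeg x N) x ⟨by rw [length_initSeg], fun n hn hd => ?_⟩)
  rw [length_initSeg] at hn
  rw [← anchor_initSeg_eventually hconst hmoves hn]
  exact hmoves n hn hd

/-- The strategy profile in which each agent `i` always follows its strategy in force, where `s i r`
is the strategy that is available to `i` at the history `r`. -/
def profile (d : List C → A) (val : List C → V) (s : A → List C → List C → C) (w : List C) : C :=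
  inForce d val (s (d w)) (d w) w

end Anchor

theorem isSubgamePerfect_of_winning {C O : Type} {G : SeqGame (Fin 2) C O}
    (hanti : ∀ x y, G.pref 0 x y ↔ G.pref 1 y x) {U V : List C → Set O} {σ : List C → C}
    (hU : ∀ l, Winning G.d 0 σ l (G.v ⁻¹' U l)) (hV : ∀ l, Winning G.d 1 σ l (G.v ⁻¹' V l))
    (hUV : ∀ l, ∀ x ∈ U l, ∀ y ∈ V l, ¬ G.pref 0 x y) : G.IsSubgamePerfect σ := by
  intro l a τ hτ
  fin_cases a
  · exact hUV l _ ((hU l).play_mem fun _ _ => rfl) _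
      ((hV l).play_mem fun w hw => hτ w (by simp [hw]))
  · exact fun hp => hUV l _ ((hU l).play_mem fun w hw => hτ w (by simp [hw])) _
      ((hV l).play_mem fun _ _ => rfl) ((hanti _ _).2 hp)

section Rank

variable {O : Type} {r : O → O → Prop}

/-- The outcomes that are the top of an `r`-chain of length `j`. -/
def rankAtLeast (r : O → O → Prop) : ℕ → Set O
  | 0 => Set.univ
  | j + 1 => {x | ∃ y ∈ rankAtLeast r j, r y x}

theorem rankAtLeast_antitone (r : O → O → Prop) : Antitone (rankAtLeast r) := by
  refine antitone_nat_of_succ_le fun j => ?_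
  induction j with
  | zero => exact Set.subset_univ _
  | succ j ih => exact fun x ⟨y, hy, hr⟩ => ⟨y, ih hy, hr⟩

theorem isUpper_rankAtLeast (r : O → O → Prop) (j : ℕ) : IsUpper r (rankAtLeast r j) :=
  fun x hx _ hr => rankAtLeast_antitone r j.le_succ ⟨x, hx, hr⟩

theorem le_ncard_of_mem_rankAtLeast [Finite O] (hr : ∀ x, ¬ Relation.TransGen r x x) {j : ℕ}
    {x : O} (hx : x ∈ rankAtLeast r j) : j ≤ {y | Relation.TransGen r y x}.ncard := by
  induction j generalizing x with
  | zero => exact Nat.zero_le _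
  | succ j ih =>
    obtain ⟨y, hy, hyx⟩ := hx
    refine (ih hy).trans_lt (Set.ncard_lt_ncard ⟨fun z hz => Relation.TransGen.tail hz hyx,
      fun h => hr y (h (Relation.TransGen.single hyx))⟩ (Set.toFinite _))

theorem rankAtLeast_card [Finite O] (hr : WellFounded fun x y => r y x) :
    rankAtLeast r (Nat.card O) = ∅ := by
  have hacyclic : ∀ x, ¬ Relation.TransGen r x x := fun x h =>
    hr.transGen.irrefl.irrefl x (Relation.transGen_swap.2 h)
  refine Set.eq_empty_of_forall_notMem fun x hx => ?_
  refine (le_ncard_of_mem_rankAtLeast hacyclic hx).not_gt ?_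
  rw [← Set.ncard_univ]
  exact Set.ncard_lt_ncard (Set.ssubset_univ_iff.2 fun h =>
    hacyclic x (Set.eq_univ_iff_forall.1 h x)) (Set.toFinite _)

end Rank

section Threshold

variable {C : Type} {d : List C → Fin 2} {S : ℕ → Set (ℕ → C)} {win : List C → ℕ → Fin 2}
  {t : List C → ℕ → List C → C} {k : ℕ}

/-- The value of the subgame at `w`: the greatest threshold `j ≤ k` for which player `0` wins, where
`win w j` is the winner for the threshold `j`. -/
def threshold (win : List C → ℕ → Fin 2) (k : ℕ) (w : List C) : ℕ :=
  Nat.findGreatest (fun j => win w j = 0) k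

/-- The profile that is assembled from winning strategies `t w j` for all thresholds `j` in the
subgames at all histories `w`: from a history with value `v`, player `0` defends the threshold `v`
and player `1` the threshold `v + 1`. -/
def thresholdProfile [DecidableEq C] (d : List C → Fin 2) (win : List C → ℕ → Fin 2)
    (t : List C → ℕ → List C → C) (k : ℕ) : List C → C :=
  profile d (threshold win k) fun i r => t r (threshold win k r + i)

variable (h : ∀ w j, Winning d (win w j) (t w j) w (winSet (win w j) (S j)))
include h

theorem win_eq_of_winning {i : Fin 2} {u : List C → C} {w : List C} {j : ℕ}
    (hu : Winning d i u w (winSet i (S j))) : win w j = i :=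
  (h w j).winner_unique hu

theorem win_threshold [Nonempty C] (hzero : S 0 = Set.univ) (w : List C) :
    win w (threshold win k w) = 0 := by
  have hwin : win w 0 = 0 :=
    win_eq_of_winning h (u := fun _ => Classical.arbitrary C) fun x _ => by simp [winSet, hzero]
  exact Nat.findGreatest_spec (P := fun j => win w j = 0) (Nat.zero_le k) hwin

theorem win_threshold_succ [Nonempty C] (hzero : S 0 = Set.univ) (hk : S k = ∅) (w : List C) :
    win w (threshold win k w + 1) = 1 := by
  have hone : win w k = 1 :=
    win_eq_of_winning h (u := fun _ => Classical.arbitrary C) fun x _ => by simp [winSet, hk]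
  have hle : threshold win k w ≤ k := Nat.findGreatest_le k
  have hlt : threshold win k w < k := hle.lt_of_ne fun heq => by
    have hwin := win_threshold (k := k) h hzero w
    rw [heq, hone] at hwin
    exact absurd hwin (by decide)
  exact Fin.eq_one_of_ne_zero _
    (Nat.findGreatest_is_greatest (P := fun j => win w j = 0) (Nat.lt_succ_self _) hlt)

variable [DecidableEq C] [Nonempty C] (hanti : Antitone S) (hzero : S 0 = Set.univ) (hk : S k = ∅)
include hanti hzero

theorem winning_thresholdProfile_zero (l : List C) :
    Winning d 0 (thresholdProfile d win t k) l (S (threshold win k l)) := by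
  have hle (w : List C) : threshold win k w ≤ k := Nat.findGreatest_le k
  have hwf : WellFounded fun w w' => threshold win k w' < threshold win k w :=
    Subrelation.wf (fun {w _} hlt => tsub_lt_tsub_left_of_le (hle w) hlt)
      (measure fun w => k - threshold win k w).wf
  refine (winning_inForce (s := fun r => t r (threshold win k r + (0 : Fin 2))) hanti hwf
    (fun r => ?_) (fun u r r' hu => ?_) l).congr fun w hw => ?_
  · simpa [winSet, win_threshold h hzero r] using h r (threshold win k r)
  · exact Nat.le_findGreatest (hle r') (win_eq_of_winning h hu)
  · simp only [thresholdProfile, profile, hw]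

include hk

theorem winning_thresholdProfile_one (l : List C) :
    Winning d 1 (thresholdProfile d win t k) l (S (threshold win k l + 1))ᶜ := by
  refine (winning_inForce (V := ℕᵒᵈ) (val := threshold win k)
    (s := fun r => t r (threshold win k r + (1 : Fin 2)))
    (T := fun v : ℕ => (S (v + 1))ᶜ) (fun v v' hvv' => ?_) (measure (threshold win k)).wf
    (fun r => ?_) (fun u r r' hu => ?_) l).congr fun w hw => ?_
  · exact Set.compl_subset_compl.2 (hanti (Nat.succ_le_succ hvv'))
  · simpa [winSet, win_threshold_succ h hzero hk r] using h r (threshold win k r + 1)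
  · by_contra hlt
    have hlt : threshold win k r' < threshold win k r := not_le.1 hlt
    have hone : win r (threshold win k r) = 1 := win_eq_of_winning h
      (hu.mono (Set.compl_subset_compl.2 (hanti hlt)))
    rw [win_threshold h hzero] at hone
    exact absurd hone (by decide)
  · simp only [thresholdProfile, profile, hw]
    rfl

end Threshold

theorem isSubgamePerfect_thresholdProfile {C O : Type} [DecidableEq C] [Nonempty C] [Finite O]
    {G : SeqGame (Fin 2) C O} (hanti : ∀ x y, G.pref 0 x y ↔ G.pref 1 y x)
    (hwf : WellFounded fun x y => G.pref 0 y x) {win : List C → ℕ → Fin 2}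
    {t : List C → ℕ → List C → C}
    (h : ∀ w j, Winning G.d (win w j) (t w j) w
      (winSet (win w j) (G.v ⁻¹' rankAtLeast (G.pref 0) j))) :
    G.IsSubgamePerfect (thresholdProfile G.d win t (Nat.card O)) := by
  have hS : Antitone fun j => G.v ⁻¹' rankAtLeast (G.pref 0) j := fun _ _ hij =>
    Set.preimage_mono (rankAtLeast_antitone _ hij)
  have hcard : G.v ⁻¹' rankAtLeast (G.pref 0) (Nat.card O) = ∅ := by
    rw [rankAtLeast_card hwf, Set.preimage_empty]
  exact isSubgamePerfect_of_winning hanti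
    (V := fun l => (rankAtLeast (G.pref 0) (threshold win (Nat.card O) l + 1))ᶜ)
    (winning_thresholdProfile_zero h hS rfl) (winning_thresholdProfile_one h hS rfl hcard)
    fun _ x hx y hy hxy => hy ⟨x, hx, hxy⟩

/-! ### The reduction -/

section Pointclass

theorem rescale_preimage_prepend (w : List Bool) (S : Set Cantor) :
    rescale w (prepend w ⁻¹' S) = S ∩ clopenOf [w] := by
  ext y
  constructor
  · rintro ⟨x, hx, rfl⟩
    exact ⟨hx, w, List.mem_singleton_self w, x, rfl⟩
  · rintro ⟨hy, _, hw, x, rfl⟩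
    obtain rfl := List.mem_singleton.1 hw
    exact ⟨x, hy, rfl⟩

theorem rescale_injective (w : List Bool) : Function.Injective (rescale w) := by
  have himage : rescale w = Set.image (prepend w) := by
    funext U
    ext y
    simp [rescale, eq_comm]
  exact himage ▸ (prepend_injective w).image_injective

theorem MultiFun.IsComputable.nonempty_val {X Y : RepSpace} {f : MultiFun X Y}
    (hf : f.IsComputable) {x : X.carrier} (hx : x ∈ f.dom) : (f.val x).Nonempty := by
  obtain ⟨F, _, hF⟩ := hf
  obtain ⟨p, hp⟩ := X.surjective x
  obtain ⟨_, _, y, hy, _⟩ := hF p x hp hx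
  exact ⟨y, hy⟩

variable {Γ : RepPointclass} (hinter : Γ.clopenInter.IsComputable)
  (hinv : Γ.rescalingInv.IsComputable)
include hinter

theorem RepPointclass.Mem.inter_clopenOf {S : Set Cantor} (hS : Γ.Mem S) (L : List (List Bool)) :
    Γ.Mem (S ∩ clopenOf L) := by
  obtain ⟨V, hV⟩ := hinter.nonempty_val (x := (L, ⟨S, hS⟩)) trivial
  exact hV ▸ V.2

include hinv

theorem RepPointclass.Mem.preimage_prepend {S : Set Cantor} (hS : Γ.Mem S) (w : List Bool) :
    Γ.Mem (prepend w ⁻¹' S) := by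
  obtain ⟨V, hV⟩ := hinv.nonempty_val (x := (w, ⟨_, hS.inter_clopenOf hinter [w]⟩))
    ⟨_, (rescale_preimage_prepend w S).symm⟩
  have heq := rescale_injective w ((rescale_preimage_prepend w S).trans hV)
  exact heq ▸ V.2

theorem ComputableMap.preimage_prepend {α : Type} [Primcodable α] {X : RepSpace}
    {S : X.carrier → α → Γ.space.carrier} {w : X.carrier → α → List Bool}
    (hS : ComputableMap X Γ.space S) (hw : UniformlyComputable X w) :
    ComputableMap X Γ.space fun x a =>
      (⟨_, (S x a).2.preimage_prepend hinter hinv (w x a)⟩ : Γ.space.carrier) := by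
  have hcylinder : ComputableMap X Γ.space fun x a =>
      (⟨_, (S x a).2.inter_clopenOf hinter [w x a]⟩ : Γ.space.carrier) :=
    .realize hinter
      (.mk (.discrete (.map (Primrec.list_cons.comp .id (.const [])) hw)) hS)
      (fun _ _ => trivial) fun _ _ _ hV => Subtype.ext hV
  exact .realize hinv (.mk (.discrete hw) hcylinder)
    (fun _ _ => ⟨_, (rescale_preimage_prepend _ _).symm⟩)
    fun _ _ _ hV => Subtype.ext (rescale_injective _ (hV.symm.trans
      (rescale_preimage_prepend _ _).symm))

end Pointclass

section Profile

namespace UniformlyComputable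

variable {A C V : Type} [Primcodable A] [Primcodable C] [Primcodable V] [DecidableEq A]
  [DecidableEq V] {X : RepSpace}

theorem threshold {win : X.carrier → List C → ℕ → Fin 2} {k : X.carrier → ℕ}
    (hwin : UniformlyComputable X fun x (a : List C × ℕ) => win x a.1 a.2)
    (hk : UniformlyComputable X fun x (_ : List C) => k x) :
    UniformlyComputable X fun x => threshold (win x) (k x) :=
  .findGreatest hk (.decide_eq hwin (.const 0))

variable [DecidableEq C] [Inhabited C]

theorem anchor {d : X.carrier → List C → A} {val : X.carrier → List C → V}
    {s : X.carrier → A → List C → List C → C} (hd : UniformlyComputable X d)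
    (hval : UniformlyComputable X val)
    (hs : UniformlyComputable X fun x (a : A × List C × List C) => s x a.1 a.2.1 a.2.2) :
    UniformlyComputable X fun x (a : A × List C) =>
      anchor (d x) (val x) (s x a.1) a.1 a.2 := by
  have hi : UniformlyComputable X fun _ (y : (A × List C) × List C × C × List C) => y.1.1 :=
    .comp .fst .fst
  have hu : UniformlyComputable X fun _ (y : (A × List C) × List C × C × List C) => y.2.1 :=
    .comp .fst .snd
  have hb : UniformlyComputable X fun _ (y : (A × List C) × List C × C × List C) => y.2.2.1 :=
    .comp .fst (.comp .snd .snd)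
  have hr : UniformlyComputable X fun _ (y : (A × List C) × List C × C × List C) => y.2.2.2 :=
    .comp .snd (.comp .snd .snd)
  have hub := map₂ Primrec.list_concat hu hb
  have hmove := decide_imp (.decide_eq (hd.comp hu) hi)
    (.decide_eq hb (hs.comp (.mk hi (.mk hr hu))))
  exact .reverseRecOn .snd (.const [])
    (.ite (.decide_and (.decide_eq (hval.comp hub) (hval.comp hu)) hmove) hr hub)

theorem profile {d : X.carrier → List C → A} {val : X.carrier → List C → V}
    {s : X.carrier → A → List C → List C → C} (hd : UniformlyComputable X d)
    (hval : UniformlyComputable X val)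
    (hs : UniformlyComputable X fun x (a : A × List C × List C) => s x a.1 a.2.1 a.2.2) :
    UniformlyComputable X fun x => profile (d x) (val x) (s x) :=
  hs.comp (.mk hd (.mk ((anchor hd hval hs).comp (.mk hd .id)) .id))

theorem thresholdProfile {d : X.carrier → List C → Fin 2}
    {win : X.carrier → List C → ℕ → Fin 2} {t : X.carrier → List C → ℕ → List C → C}
    {k : X.carrier → ℕ} (hd : UniformlyComputable X d)
    (hwin : UniformlyComputable X fun x (a : List C × ℕ) => win x a.1 a.2)
    (ht : UniformlyComputable X fun x (a : List C × ℕ × List C) => t x a.1 a.2.1 a.2.2)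
    (hk : UniformlyComputable X fun x (_ : List C) => k x) :
    UniformlyComputable X fun x => thresholdProfile (d x) (win x) (t x) (k x) := by
  have hval := threshold hwin hk
  refine profile hd hval (ht.comp (.mk (.comp .fst .snd) (.mk ?_ (.comp .snd .snd))))
  exact map₂ Primrec.nat_add (hval.comp (.comp .fst .snd)) (map Primrec.fin_val .fst)

end UniformlyComputable

end Profile

section Rank

/-- The characteristic word of `rankAtLeast r j` for a relation `r` on `{0, …, k-1}`. -/
def rankWord (k : ℕ) (r : ℕ → ℕ → Bool) : ℕ → List Bool
  | 0 => (List.range k).map fun _ => true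
  | j + 1 => (List.range k).map fun x =>
      (List.range k).any fun y => (rankWord k r j).getD y false && r y x

theorem length_rankWord (k : ℕ) (r : ℕ → ℕ → Bool) (j : ℕ) : (rankWord k r j).length = k := by
  cases j <;> simp [rankWord]

theorem wordSet_rankWord (k : ℕ) (r : ℕ → ℕ → Bool) (j : ℕ) :
    wordSet k (rankWord k r j) = rankAtLeast (fun x y : Fin k => r x y) j := by
  induction j with
  | zero => ext x; simp [wordSet, rankWord, rankAtLeast]
  | succ j ih =>
    ext x
    simp [rankAtLeast, ← ih, wordSet, rankWord, Fin.exists_iff, List.getD_eq_getElem?_getD,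
      Option.getD_eq_iff, and_left_comm]

theorem UniformlyComputable.rankWord {X : RepSpace} {k : X.carrier → ℕ}
    {r : X.carrier → ℕ → ℕ → Bool} (hk : UniformlyComputable X fun x (_ : Unit) => k x)
    (hr : UniformlyComputable X fun x (a : ℕ × ℕ) => r x a.1 a.2) :
    UniformlyComputable X fun x => rankWord (k x) (r x) := by
  have hsize {α : Type} [Primcodable α] : UniformlyComputable X fun x (_ : α) => k x :=
    hk.comp (.const ())
  have hentry : UniformlyComputable X fun x (a : ((ℕ × ℕ × List Bool) × ℕ) × ℕ) =>
      a.1.1.2.2.getD a.2 false && r x a.2 a.1.2 :=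
    .map₂ Primrec.and
      (.map₂ (Primrec.list_getD false) (.comp .snd (.comp .snd (.comp .fst .fst))) .snd)
      (hr.comp (.mk .snd (.comp .snd .fst)))
  refine (nat_rec .id (range_map hsize (.const true))
    (range_map hsize (range_any hsize hentry))).of_eq fun x j => ?_
  induction j with
  | zero => rfl
  | succ j ih => simp only [Weih.rankWord, ← ih]

end Rank

section Games

variable {Γ : RepPointclass}

namespace AntagonisticGame

/-- The preference of player `0`, extended to the natural numbers. -/
noncomputable def prefers (G : AntagonisticGame Γ) (x y : ℕ) : Bool := by
  classical
  exact decide (∃ (hx : x < G.numOutcomes) (hy : y < G.numOutcomes), G.game.pref 0 ⟨x, hx⟩ ⟨y, hy⟩)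

theorem prefers_eq (G : AntagonisticGame Γ) :
    (fun x y : Fin G.numOutcomes => (G.prefers x y : Prop)) = G.game.pref 0 := by
  funext x y
  simp [prefers]

/-- The set of the plays whose outcomes have rank at least `j` for player `0`. -/
def superlevel (G : AntagonisticGame Γ) (j : ℕ) : Γ.space.carrier :=
  ⟨G.game.v ⁻¹' rankAtLeast (G.game.pref 0) j, G.measurable 0 _ (isUpper_rankAtLeast _ _)⟩

variable {α : Type} [Primcodable α]

theorem uniformlyComputable_numOutcomes :
    UniformlyComputable (gameSpace Γ) fun G (_ : α) => G.numOutcomes :=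
  .of_named (.query (.const (Nat.pair 0 0))) fun z _ => z.2.num

theorem computableMap_turn :
    ComputableMap (gameSpace Γ) (tableSpace (Fin 2)) fun G (_ : α) => G.game.d :=
  .table (.of_encode (.of_named (.query (.map₂ Primrec₂.natPair (.const 1) (.encoding .snd)))
    fun z a => z.2.turn a.2))

theorem uniformlyComputable_prefers :
    UniformlyComputable (gameSpace Γ) fun G (a : ℕ × ℕ) => G.prefers a.1 a.2 := by
  have hsize := (uniformlyComputable_numOutcomes (Γ := Γ) (α := ℕ × ℕ)).named
  have hquery : UniformlyComputable (gameSpace Γ).named fun z (a : ℕ × ℕ) =>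
      z.1.1 (Nat.pair 2 (encode ((0 : Fin 2), a))) :=
    .query (.map₂ Primrec₂.natPair (.const 2) (.encoding (.mk (.const 0) .id)))
  refine .of_named (.decide_and (.map₂ Primrec.nat_lt.decide .fst hsize)
    (.decide_and (.map₂ Primrec.nat_lt.decide .snd hsize) (.decide_eq hquery (.const 1)))) ?_
  rintro ⟨⟨p, G⟩, hp⟩ ⟨x, y⟩
  have hname (hx : x < G.numOutcomes) (hy : y < G.numOutcomes) :
      p (Nat.pair 2 (encode ((0 : Fin 2), x, y))) = 1 ↔ G.game.pref 0 ⟨x, hx⟩ ⟨y, hy⟩ :=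
    ⟨fun h => by_contra fun hn =>
      absurd (h.symm.trans (hp.pref_neg 0 ⟨x, hx⟩ ⟨y, hy⟩ hn)) one_ne_zero, hp.pref_pos 0 _ _⟩
  exact decide_eq_decide.2 ⟨fun ⟨hx, hy, h⟩ => ⟨hx, hy, (hname hx hy).1 h⟩,
    fun ⟨hx, hy, h⟩ => ⟨hx, hy, (hname hx hy).2 h⟩⟩

theorem computableMap_superlevel : ComputableMap (gameSpace Γ) Γ.space superlevel := by
  refine ⟨fun z j => sect (sect z.1.1 3)
    (encode ((0 : Fin 2), rankWord z.1.2.numOutcomes z.1.2.prefers j)), ?_, fun z j => ?_⟩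
  · have hword := (UniformlyComputable.rankWord (uniformlyComputable_numOutcomes (Γ := Γ))
      uniformlyComputable_prefers).named
    exact .query (.map₂ Primrec₂.natPair (.const 3) (.map₂ Primrec₂.natPair
      (.encoding (.mk (.const 0) (hword.comp .fst))) .snd))
  · have hset : wordSet z.1.2.numOutcomes (rankWord z.1.2.numOutcomes z.1.2.prefers j) =
        rankAtLeast (z.1.2.game.pref 0) j := by
      rw [wordSet_rankWord]
      exact congrArg (rankAtLeast · j) z.1.2.prefers_eq
    have hname := z.2.upper 0 (rankWord _ z.1.2.prefers j) (length_rankWord _ _ j)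
    rw [hset] at hname
    exact hname (isUpper_rankAtLeast _ j)

variable (hinter : Γ.clopenInter.IsComputable) (hinv : Γ.rescalingInv.IsComputable)

/-- The win/lose game that is played from the history `w` on, in which player `0` wins the plays
whose outcomes have rank at least `j`. -/
def thresholdGame (G : AntagonisticGame Γ) (w : List Bool) (j : ℕ) : (winLoseSpace Γ).carrier :=
  (fun u => G.game.d (w ++ u), ⟨_, (G.superlevel j).2.preimage_prepend hinter hinv w⟩)

theorem computableMap_thresholdGame :
    ComputableMap (gameSpace Γ) (winLoseSpace Γ) fun G (a : List Bool × ℕ) =>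
      G.thresholdGame hinter hinv a.1 a.2 := by
  have happend : UniformlyComputable (gameSpace Γ)
      fun _ (a : (List Bool × ℕ) × List Bool) => a.1.1 ++ a.2 :=
    .map₂ Primrec.list_append (.comp .fst .fst) .snd
  exact .mk (.table (computableMap_turn.lookUp.comp (.mk (.const ()) happend)))
    ((computableMap_superlevel.reindex .snd).preimage_prepend hinter hinv .fst)

theorem winning_of_det_of_win {G : AntagonisticGame Γ} {w : List Bool} {j : ℕ} {i : Fin 2}
    {σ : List Bool → Bool} (hi : i ∈ (Win Γ).val (G.thresholdGame hinter hinv w j))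
    (hσ : σ ∈ (Det Γ).val (G.thresholdGame hinter hinv w j)) :
    Winning G.game.d i (fun u => σ (u.drop w.length)) w
      (winSet i (G.game.v ⁻¹' rankAtLeast (G.game.pref 0) j)) := by
  refine Winning.shift ?_
  rw [preimage_winSet]
  exact winning_of_isNash hi hσ

/-- The sequence of all threshold games of an antagonistic game, in which the threshold game for
`(w, j)` has the index `encode (w, j)`; the numbers that encode no pair get a default game. -/
def thresholdGames (G : AntagonisticGame Γ) (n : ℕ) : (winLoseSpace Γ).carrier :=
  let a := (decode n : Option (List Bool × ℕ)).getD ([], 0)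
  G.thresholdGame hinter hinv a.1 a.2

/-- The profile of an antagonistic game that is assembled from the winners and the winning
strategies of its threshold games. -/
def assemble (G : AntagonisticGame Γ) (wins : ℕ → Fin 2) (strats : ℕ → List Bool → Bool) :
    List Bool → Bool :=
  thresholdProfile G.game.d (fun w j => wins (encode (w, j)))
    (fun w j u => strats (encode (w, j)) (u.drop w.length)) G.numOutcomes

theorem computableMap_thresholdGames :
    ComputableMap (gameSpace Γ) (seqSpace (winLoseSpace Γ)) fun G (_ : α) =>
      G.thresholdGames hinter hinv :=
  .seq ((computableMap_thresholdGame hinter hinv).reindex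
    (.of_primrec (Primrec.option_getD.comp (Primrec.decode.comp .snd) (.const _))))

/-- The represented space of antagonistic games together with sequences of winners and of strategy
profiles, which are the inputs of `assemble`. -/
abbrev solvedGameSpace (Γ : RepPointclass) : RepSpace :=
  prodSpace (gameSpace Γ)
    (prodSpace (seqSpace (discreteSpace (Fin 2))) (seqSpace (tableSpace Bool)))

theorem computableMap_assemble :
    ComputableMap (solvedGameSpace Γ) (tableSpace Bool) fun z (_ : α) =>
      z.1.assemble z.2.1 z.2.2 := by
  have hgame : ComputableMap (solvedGameSpace Γ) (gameSpace Γ) fun z (_ : Unit) => z.1 := .fst .id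
  have hwins : UniformlyComputable (β := Fin 2) (solvedGameSpace Γ) fun z (n : ℕ) => z.2.1 n :=
    (ComputableMap.fst (.snd .id)).coordinate.toUniformlyComputable.comp (.mk (.const ()) .id)
  have hstrats : UniformlyComputable (solvedGameSpace Γ) fun z (a : ℕ × List Bool) =>
      z.2.2 a.1 a.2 :=
    (ComputableMap.snd (.snd .id)).coordinate.lookUp.comp (.mk (.mk (.const ()) .fst) .snd)
  refine .table (.comp (.thresholdProfile ?_ ?_ ?_ ?_) .snd)
  · exact hgame.comp_uniformlyComputable (computableMap_turn.lookUp.comp (.mk (.const ()) .id))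
  · exact hwins.comp (.encoding .id)
  · exact hstrats.comp (.mk (.encoding (.mk .fst (.comp .fst .snd)))
      (.map₂ Primrec.list_drop (.map Primrec.list_length .fst) (.comp .snd .snd)))
  · exact hgame.comp_uniformlyComputable uniformlyComputable_numOutcomes

theorem isSubgamePerfect_assemble {G : AntagonisticGame Γ} {wins : ℕ → Fin 2}
    {strats : ℕ → List Bool → Bool}
    (hwins : wins ∈ (Win Γ).parallel.val (G.thresholdGames hinter hinv))
    (hstrats : strats ∈ (Det Γ).parallel.val (G.thresholdGames hinter hinv)) :
    G.game.IsSubgamePerfect (G.assemble wins strats) := by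
  have hgames (w : List Bool) (j : ℕ) : G.thresholdGames hinter hinv (encode (w, j)) =
      G.thresholdGame hinter hinv w j := by
    simp only [thresholdGames, encodek, Option.getD_some]
  have hwinning (w : List Bool) (j : ℕ) := winning_of_det_of_win hinter hinv
    (hgames w j ▸ hwins (encode (w, j))) (hgames w j ▸ hstrats (encode (w, j)))
  simpa [assemble] using
    isSubgamePerfect_thresholdProfile G.antagonistic (G.wellFounded 0) hwinning

end AntagonisticGame

end Games

end Weih

theorem theorem23_general (Γ : Weih.RepPointclass) (hinter : Γ.clopenInter.IsComputable)
    (hinv : Γ.rescalingInv.IsComputable) :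
    Weih.WeihrauchReducible (Weih.SPE Γ)
      ((Weih.Win Γ).parallel.prod (Weih.Det Γ).parallel) := by
  have hgames := Weih.AntagonisticGame.computableMap_thresholdGames (α := Unit) hinter hinv
  refine Weih.weihrauchReducible_of_computableMap
    (h := fun G => (G.thresholdGames hinter hinv, G.thresholdGames hinter hinv))
    (hgames.mk hgames) Weih.AntagonisticGame.computableMap_assemble
    (fun _ _ => ⟨fun _ => trivial, fun _ => trivial⟩) fun _ _ _ hy => ?_
  exact Weih.AntagonisticGame.isSubgamePerfect_assemble hinter hinv hy.1 hy.2

theorem theorem23 (Γ : Weih.RepPointclass) (hΓ : Γ.IsDeterminedPointclass) :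
    Weih.WeihrauchReducible (Weih.SPE Γ)
      ((Weih.Win Γ).parallel.prod (Weih.Det Γ).parallel) :=
  theorem23_general Γ hΓ.clopenInter_computable hΓ.rescalingInv_computable
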